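/- **Theorem (Global-in-time uniqueness).** Let $\ell,T,\beta,p,q>0$ and $I=(0,\ell)$. Write $H^3_0(I)$ for the set of $\varphi\in H^3(I)$ such that $\varphi,\varphi',\varphi''$ vanish at $0$ and $\ell$. For $g\in L^2(I)$ we write $w=(1-\beta\frac{d^2}{dx^2})^{-1}g$ if $w\in H^2(I)$ and $w-\beta w''=g$ in $I$ (no boundary condition is prescribed for $w$). Point values of Sobolev functions are those of their continuous representatives. Suppose: * (i1) $u_0,u_1\in H^4(I)$ and $\varphi\in H^3_0(I)$. * (i2) $v_0(x)=u_1(x)-u_1(\ell)\frac x\ell$ and $v_1(x)=u_2(x)-u_2(\ell)\frac x\ell$, where $u_2=(1-\beta\frac{d^2}{dx^2})^{-1}u_0''$, and $v_0,v_1\in H^1_0(I)\cap H^2(I)$. * (i3) $\alpha^{-1}:=\int_0^\ell\varphi'(x)u_0''(x)\,dx\neq0$. * (i4) $f\in H^4(0,T)$ and, with $k_0:=\alpha\big(f'''(0)+\int_0^\ell v_0(x)\varphi'''(x)\,dx\big)$, $$\int_0^\ell(\varphi-\beta\varphi'')u_0'\,dx=f(0),\quad \int_0^\ell(\varphi-\beta\varphi'')u_1'\,dx=f'(0),\quad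 \int_0^\ell(\varphi-\beta\varphi'')u_2'\,dx=f''(0),$$ $$\int_0^\ell(\varphi-\beta\varphi'')\,w\,dx=f'''(0)\quad\text{for some } w=\Big(1-\beta\frac{d^2}{dx^2}\Big)^{-1}[u_1'''-k_0u_0'''].$$ * (i5) $\psi(\ell)\ne0$, where $\psi(x)=\int_0^x\varphi(s)\,ds-\beta\varphi'(x)$. Let $\tau\in(0,T]$. A *solution of the inverse problem on $(0,\tau)$* is a triple $$v\in H^2(0,\tau;H^1_0(I)\cap H^2(I)),\qquad k\in H^1(0,\tau),\qquad y\in H^3(0,\tau)$$ that satisfies, with $z:=py'+qy$, $$v_{tt}-v_{xx}-\beta v_{xxtt}+k(t)u_0''(x)+\int_0^tk(t-s)v_{xx}(x,s)\,ds=z''(t)\frac x\ell\quad\text{for a.e. }(x,t)\in I\times(0,\tau),$$ $$\Big[v_x-\int_0^tk(t-s)v_x(x,s)\,ds\Big]_{x=\ell}=y''(t)+k(t)u_0'(\ell)+\frac1\ell\Big(z(t)-\int_0^tk(t-s)z(s)\,ds\Big)\quad\text{for a.e. }t\in(0,\tau),$$ $$v|_{t=0}=v_0,\qquad v_t|_{t=0}=v_1\qquad\text{in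 } I,$$ $$\int_0^\ell(\varphi(x)-\beta\varphi''(x))\Big[v_x(x,t)-\frac{z(t)}\ell\Big]dx=f'(t)\quad\text{for a.e. }t\in(0,\tau)$$ (the conditions $v|_{x=0}=v|_{x=\ell}=0$ are contained in the space of $v$). If $(v^{(1)},k^{(1)},y^{(1)})$ and $(v^{(2)},k^{(2)},y^{(2)})$ are two solutions of the inverse problem on $(0,\tau)$, both of which satisfy the second part of (i5), $$(y^{(j)})''(0)=\frac1{\psi(\ell)}\Big[f'(0)-k_0f(0)+\int_0^\ell\psi(x)\big(u_1''(x)-k_0u_0''(x)\big)\,dx\Big],\qquad j=1,2,$$ then $(v^{(1)},k^{(1)},y^{(1)})=(v^{(2)},k^{(2)},y^{(2)})$. -/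

import Mathlib

open MeasureTheory Set Filter
open scoped ContDiff

noncomputable section

namespace MemoryKernel

/-- Lebesgue measure on the open interval `(a, b)`. -/
abbrev ivl (a b : ℝ) : Measure ℝ := volume.restrict (Ioo a b)

section Spaces

variable {E : Type*} [NormedAddCommGroup E] [NormedSpace ℝ E]

/-- `g` is the `j`-th weak derivative of `u` on `(a, b)`: for every `η ∈ C_c^∞(a, b)`,
`∫ η⁽ʲ⁾ u = (-1)ʲ ∫ η g` (Bochner integrals with values in the Banach space `E`). -/
def IsWeakDeriv (a b : ℝ) (j : ℕ) (u g : ℝ → E) : Prop :=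
  ∀ η : ℝ → ℝ, ContDiff ℝ ∞ η → HasCompactSupport η → tsupport η ⊆ Ioo a b →
    ∫ t, iteratedDeriv j η t • u t ∂(ivl a b) = (-1 : ℝ) ^ j • ∫ t, η t • g t ∂(ivl a b)

lemma integrable_smul_of_Lp (a b : ℝ) {θ : ℝ → ℝ} (hθ : Continuous θ) (u : Lp E 2 (ivl a b)) :
    Integrable (fun t => θ t • u t) (ivl a b) := by
  have hu : Integrable u (ivl a b) := (Lp.memLp u).integrable (by norm_num)
  obtain ⟨C, hC⟩ := (isCompact_Icc (a := a) (b := b)).exists_bound_of_continuousOn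
    hθ.continuousOn
  refine hu.bdd_smul C hθ.aestronglyMeasurable ?_
  filter_upwards [ae_restrict_mem measurableSet_Ioo] with t ht
  exact hC t (Ioo_subset_Icc_self ht)

lemma IsWeakDeriv.congr {a b : ℝ} {j : ℕ} {u g u' g' : ℝ → E} (h : IsWeakDeriv a b j u g)
    (hu : u' =ᵐ[ivl a b] u) (hg : g' =ᵐ[ivl a b] g) : IsWeakDeriv a b j u' g' := by
  intro η h1 h2 h3
  have e1 : ∫ t, iteratedDeriv j η t • u' t ∂(ivl a b)
      = ∫ t, iteratedDeriv j η t • u t ∂(ivl a b) :=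
    integral_congr_ae (by filter_upwards [hu] with t ht; rw [ht])
  have e2 : ∫ t, η t • g' t ∂(ivl a b) = ∫ t, η t • g t ∂(ivl a b) :=
    integral_congr_ae (by filter_upwards [hg] with t ht; rw [ht])
  rw [e1, e2, h η h1 h2 h3]

/-- The tuples `(u, u', …, u⁽ᵐ⁾)` in `L²(a, b; E)` that consist of a function and its weak
derivatives up to the order `m`. -/
def sobolevSubmodule (m : ℕ) (a b : ℝ) (E : Type*) [NormedAddCommGroup E] [NormedSpace ℝ E] :
    Submodule ℝ (PiLp 2 fun _ : Fin (m + 1) => Lp E 2 (ivl a b)) where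
  carrier := {U | ∀ j : Fin (m + 1), IsWeakDeriv a b j (U 0) (U j)}
  zero_mem' := by
    intro j
    have h0 : IsWeakDeriv a b j (0 : ℝ → E) 0 := by
      intro η _ _ _
      simp
    exact h0.congr (Lp.coeFn_zero _ _ _) (Lp.coeFn_zero _ _ _)
  add_mem' := by
    intro U V hU hV j
    have h0 : IsWeakDeriv a b j (U 0 + V 0 : ℝ → E) (U j + V j) := by
      intro η h1 h2 h3
      have hc : Continuous (iteratedDeriv j η) :=
        h1.continuous_iteratedDeriv j (by exact_mod_cast le_top)
      simp only [Pi.add_apply, smul_add]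
      rw [integral_add (integrable_smul_of_Lp a b hc _) (integrable_smul_of_Lp a b hc _),
        integral_add (integrable_smul_of_Lp a b h1.continuous _)
          (integrable_smul_of_Lp a b h1.continuous _),
        hU j η h1 h2 h3, hV j η h1 h2 h3, smul_add]
    exact h0.congr (Lp.coeFn_add _ _) (Lp.coeFn_add _ _)
  smul_mem' := by
    intro c U hU j
    have h0 : IsWeakDeriv a b j (c • U 0 : ℝ → E) (c • U j) := by
      intro η h1 h2 h3
      simp only [Pi.smul_apply, smul_comm _ c]
      rw [integral_smul, integral_smul, hU j η h1 h2 h3, smul_comm]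
    exact h0.congr (Lp.coeFn_smul _ _) (Lp.coeFn_smul _ _)

/-- The Sobolev space `Hᵐ(a, b; E)`, with the norm `(∑_{j ≤ m} ‖∂ʲu‖²_{L²(a,b;E)})^{1/2}`. A function
`u` is recorded together with its weak derivatives; for complete `E` these are determined by `u`. -/
abbrev Sobolev (m : ℕ) (a b : ℝ) (E : Type*) [NormedAddCommGroup E] [NormedSpace ℝ E] : Type _ :=
  sobolevSubmodule m a b E

/-- `u.d j` is the weak derivative `u⁽ʲ⁾ ∈ L²(a, b; E)` of `u ∈ Hᵐ(a, b; E)`, `0 ≤ j ≤ m`. -/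
def Sobolev.d {m : ℕ} {a b : ℝ} (u : Sobolev m a b E) (j : Fin (m + 1)) : Lp E 2 (ivl a b) :=
  (u : PiLp 2 fun _ : Fin (m + 1) => Lp E 2 (ivl a b)) j

open Classical in
/-- The continuous representative on `[a, b]` of a function class on `(a, b)`, where there is one.
(It is unique on `[a, b]` if `a < b`, and exists for `u⁽ʲ⁾` with `u ∈ Hᵐ(a, b; E)`, `j < m`.) -/
def contRep (a b : ℝ) (f : ℝ → E) : ℝ → E :=
  if h : ∃ w : ℝ → E, ContinuousOn w (Icc a b) ∧ w =ᵐ[ivl a b] f then h.choose else f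

/-- The (class of the) function `f` on `(a, b)` has a continuous representative on `[a, b]`
that vanishes at both end points. -/
def VanishesAtEnds (a b : ℝ) (f : ℝ → E) : Prop :=
  ∃ w : ℝ → E, ContinuousOn w (Icc a b) ∧ w =ᵐ[ivl a b] f ∧ w a = 0 ∧ w b = 0

/-- The `u ∈ H²(0, ℓ)` with `u(0) = u(ℓ) = 0`. -/
def h10h2Submodule (ℓ : ℝ) : Submodule ℝ (Sobolev 2 0 ℓ ℝ) where
  carrier := {u | VanishesAtEnds 0 ℓ (u.d 0)}
  zero_mem' := ⟨0, continuousOn_const, (Lp.coeFn_zero _ _ _).symm, rfl, rfl⟩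
  add_mem' := by
    rintro u v ⟨w, h1, h2, h3, h4⟩ ⟨w', h1', h2', h3', h4'⟩
    exact ⟨w + w', h1.add h1', (h2.add h2').trans (Lp.coeFn_add _ _).symm,
      by simp [h3, h3'], by simp [h4, h4']⟩
  smul_mem' := by
    rintro c u ⟨w, h1, h2, h3, h4⟩
    exact ⟨c • w, h1.const_smul c, (h2.const_smul c).trans (Lp.coeFn_smul _ _).symm,
      by simp [h3], by simp [h4]⟩

/-- `H¹₀(0, ℓ) ∩ H²(0, ℓ)`, with the norm of `H²(0, ℓ)`. -/
def H10H2 (ℓ : ℝ) : Type := h10h2Submodule ℓ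

instance (ℓ : ℝ) : NormedAddCommGroup (H10H2 ℓ) :=
  inferInstanceAs (NormedAddCommGroup (h10h2Submodule ℓ))

instance (ℓ : ℝ) : NormedSpace ℝ (H10H2 ℓ) :=
  inferInstanceAs (NormedSpace ℝ (h10h2Submodule ℓ))

/-- The weak `x`-derivatives `w, w_x, w_xx ∈ L²(0, ℓ)` of `w ∈ H¹₀(0, ℓ) ∩ H²(0, ℓ)`. -/
def H10H2.dx {ℓ : ℝ} (w : H10H2 ℓ) (j : Fin 3) : Lp ℝ 2 (ivl 0 ℓ) :=
  Sobolev.d (w.1 : Sobolev 2 0 ℓ ℝ) j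

/-- The value `w_x(ℓ)` for `w ∈ H¹₀(0, ℓ) ∩ H²(0, ℓ)`. -/
def H10H2.dxEnd {ℓ : ℝ} (w : H10H2 ℓ) : ℝ := contRep 0 ℓ (w.dx 1) ℓ

end Spaces

section Completeness

/-! Completeness of `Hᵐ(a, b; E)` and of `H¹₀ ∩ H²`; the statement of the problem does not use it. -/

lemma ivl_int {a b : ℝ} (hab : a < b) (f : ℝ → ℝ) :
    ∫ x, f x ∂(ivl a b) = ∫ x in a..b, f x := by
  rw [intervalIntegral.integral_of_le hab.le, integral_Ioc_eq_integral_Ioo]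

lemma ivl_intble {a b : ℝ} (hab : a < b) (f : ℝ → ℝ) :
    IntervalIntegrable f volume a b ↔ Integrable f (ivl a b) := by
  rw [intervalIntegrable_iff_integrableOn_Ioo_of_le hab.le]; rfl

/-- Integration by parts against a primitive. -/
lemma parts {a b : ℝ} (hab : a < b) {g η : ℝ → ℝ} (hg : Integrable g (ivl a b))
    (hη : ContDiff ℝ ∞ η) (c : ℝ) :
    ∫ x, deriv η x * (c + ∫ s in a..x, g s) ∂(ivl a b)
      = η b * (c + ∫ s in a..b, g s) - η a * c - ∫ x, η x * g x ∂(ivl a b) := by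
  have hgi := (ivl_intble hab g).2 hg
  have hG0 := hgi.absolutelyContinuousOnInterval_intervalIntegral (c := a) (by simp)
  have hc : AbsolutelyContinuousOnInterval (fun _ : ℝ => c) a b :=
    (contDiff_const.contDiffOn).absolutelyContinuousOnInterval
  have hG : AbsolutelyContinuousOnInterval (fun x => c + ∫ s in a..x, g s) a b := hc.add hG0
  have hη' : AbsolutelyContinuousOnInterval η a b :=
    ((hη.of_le (by norm_cast)).contDiffOn).absolutelyContinuousOnInterval
  have key := hη'.integral_mul_deriv_eq_deriv_mul hG
  rw [ivl_int hab, ivl_int hab]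
  have e : ∫ x in a..b, η x * deriv (fun x => c + ∫ s in a..x, g s) x
      = ∫ x in a..b, η x * g x := by
    apply intervalIntegral.integral_congr_ae
    filter_upwards [hgi.ae_hasDerivAt_integral] with x hx hx2
    have := hx (uIoc_subset_uIcc hx2) a (by simp)
    rw [(this.const_add c).deriv]
  rw [e] at key
  simp at key
  linarith

/-- A function with vanishing weak derivative is constant. -/
lemma const_of_weak {a b : ℝ} (hab : a < b) {h : ℝ → ℝ} (hh : Integrable h (ivl a b))
    (H : ∀ η : ℝ → ℝ, ContDiff ℝ ∞ η → HasCompactSupport η → tsupport η ⊆ Ioo a b →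
      ∫ t, deriv η t * h t ∂(ivl a b) = 0) : ∃ c : ℝ, h =ᵐ[ivl a b] fun _ => c := by
  classical
  let ρ : ContDiffBump ((a + b) / 2) := ⟨(b - a) / 8, (b - a) / 4, by linarith, by linarith⟩
  set r : ℝ → ℝ := ρ.normed volume with hr
  have hr1 : ContDiff ℝ ∞ r := ρ.contDiff_normed
  have hr2 : HasCompactSupport r := ρ.hasCompactSupport_normed
  have hr3 : tsupport r ⊆ Ioo a b := by
    rw [hr, ρ.tsupport_normed_eq, Real.closedBall_eq_Icc]
    intro x hx
    constructor <;> [(have := hx.1); (have := hx.2)] <;> simp only [ρ] at this <;> linarith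
  have hr4 : ∫ x, r x = 1 := ρ.integral_normed
  have bddint : ∀ θ : ℝ → ℝ, Continuous θ → Integrable (fun t => θ t * h t) (ivl a b) := by
    intro θ hθ
    obtain ⟨C, hC⟩ := (isCompact_Icc (a := a) (b := b)).exists_bound_of_continuousOn
      hθ.continuousOn
    refine hh.bdd_mul (c := C) hθ.aestronglyMeasurable ?_
    filter_upwards [ae_restrict_mem measurableSet_Ioo] with t ht
    exact hC t (Ioo_subset_Icc_self ht)
  set c : ℝ := ∫ t, r t * h t ∂(ivl a b) with hc
  refine ⟨c, ?_⟩
  have main := (isOpen_Ioo (a := a) (b := b)).ae_eq_zero_of_integral_contDiff_smul_eq_zero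
    (μ := volume) (f := fun t => h t - c) ?_ ?_
  · rw [Filter.EventuallyEq, ae_restrict_iff' measurableSet_Ioo]
    filter_upwards [main] with x hx hx2
    linarith [hx hx2]
  · exact (IntegrableOn.locallyIntegrableOn (by
      change Integrable _ (ivl a b); exact hh.sub (integrable_const c)))
  · intro η h1 h2 h3
    have hηi : Integrable η volume := h1.continuous.integrable_of_hasCompactSupport h2
    have hri : Integrable r volume := hr1.continuous.integrable_of_hasCompactSupport hr2
    set m : ℝ := ∫ x, η x with hm
    set σ : ℝ → ℝ := fun x => η x - m * r x with hσ
    have hσ1 : ContDiff ℝ ∞ σ := h1.sub (contDiff_const.mul hr1)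
    have hσi : Integrable σ volume := hηi.sub (hri.const_mul m)
    have hσ0 : ∫ x, σ x = 0 := by
      rw [hσ, integral_sub hηi (hri.const_mul m), integral_const_mul, hr4]; simp [hm]
    set θ : ℝ → ℝ := fun x => ∫ s in a..x, σ s with hθ
    have hθd : ∀ x, HasDerivAt θ (σ x) x := fun x =>
      intervalIntegral.integral_hasDerivAt_right (hσi.intervalIntegrable)
        (hσ1.continuous.stronglyMeasurableAtFilter _ _) hσ1.continuous.continuousAt
    have hθd' : deriv θ = σ := funext fun x => (hθd x).deriv
    have hθ1 : ContDiff ℝ ∞ θ := by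
      rw [contDiff_infty_iff_deriv, hθd']
      exact ⟨fun x => (hθd x).differentiableAt, hσ1⟩
    set K := tsupport η ∪ tsupport r with hK
    have hKc : IsCompact K := IsCompact.union h2 hr2
    have hKs : K ⊆ Ioo a b := union_subset h3 hr3
    have hKne : K.Nonempty := by
      have : (tsupport r).Nonempty := by
        by_contra hne
        rw [not_nonempty_iff_eq_empty, tsupport_eq_empty_iff] at hne
        rw [hne] at hr4; simp at hr4
      exact this.mono subset_union_right
    obtain ⟨l, hl, hl'⟩ := hKc.exists_isLeast hKne
    obtain ⟨u, hu, hu'⟩ := hKc.exists_isGreatest hKne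
    have hσz : ∀ x, x ∉ K → σ x = 0 := by
      intro x hx
      have := image_eq_zero_of_notMem_tsupport (fun h => hx (Or.inl h) : x ∉ tsupport η)
      have := image_eq_zero_of_notMem_tsupport (fun h => hx (Or.inr h) : x ∉ tsupport r)
      simp only [hσ]; simp_all
    have hlow : ∀ x, x < l → θ x = 0 := by
      intro x hx
      have : EqOn σ 0 (uIcc a x) := by
        intro s hs
        apply hσz; intro hsK
        have h5 := (hKs hl).1
        have h6 := hl' hsK
        rcases le_total a x with h | h
        · rw [uIcc_of_le h] at hs; linarith [hs.2]
        · rw [uIcc_of_ge h] at hs; linarith [hs.2]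
      simp only [hθ]
      rw [intervalIntegral.integral_congr this]; simp
    have htot : ∫ s in a..b, σ s = 0 := by
      rw [intervalIntegral.integral_of_le hab.le, setIntegral_eq_integral_of_forall_compl_eq_zero,
        hσ0]
      intro x hx
      exact hσz x fun hxK => hx ⟨(hKs hxK).1, (hKs hxK).2.le⟩
    have hhigh : ∀ x, u < x → θ x = 0 := by
      intro x hx
      have : EqOn σ 0 (uIcc x b) := by
        intro s hs
        apply hσz; intro hsK
        have h5 := (hKs hu).2
        have h6 := hu' hsK
        rcases le_total x b with h | h
        · rw [uIcc_of_le h] at hs; linarith [hs.1]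
        · rw [uIcc_of_ge h] at hs; linarith [hs.1]
      have e : ∫ s in x..b, σ s = 0 := by
        rw [intervalIntegral.integral_congr this]; simp
      have := intervalIntegral.integral_add_adjacent_intervals
        (hσi.intervalIntegrable (a := a) (b := x)) (hσi.intervalIntegrable (a := x) (b := b))
      simp only [hθ]; linarith
    have hsup : tsupport θ ⊆ Icc l u := by
      apply closure_minimal _ isClosed_Icc
      intro x hx
      by_contra hcon
      apply hx
      rcases lt_or_ge x l with h | h
      · exact hlow x h
      · exact hhigh x (not_le.1 fun h' => hcon ⟨h, h'⟩)
    have hz := H θ hθ1 (HasCompactSupport.of_support_subset_isCompact isCompact_Icc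
      (subset_closure.trans hsup)) (hsup.trans (Icc_subset_Ioo (hKs hl).1 (hKs hu).2))
    rw [hθd'] at hz
    have e1 : ∫ t, σ t * h t ∂(ivl a b) = (∫ t, η t * h t ∂(ivl a b)) - m * c := by
      rw [hc, ← integral_const_mul, ← integral_sub (bddint _ h1.continuous)
        ((bddint _ hr1.continuous).const_mul m)]
      congr 1; ext t; simp [hσ]; ring
    have e2 : ∫ t, η t ∂(ivl a b) = m := by
      apply setIntegral_eq_integral_of_forall_compl_eq_zero
      intro x hx
      exact image_eq_zero_of_notMem_tsupport fun h => hx (h3 h)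
    have e3 : ∫ x, η x • (h x - c) = ∫ x, η x • (h x - c) ∂(ivl a b) := by
      symm
      apply setIntegral_eq_integral_of_forall_compl_eq_zero
      intro x hx
      rw [image_eq_zero_of_notMem_tsupport fun h => hx (h3 h), zero_smul]
    rw [e3]
    have e4 : ∫ x, η x • (h x - c) ∂(ivl a b)
        = (∫ t, η t * h t ∂(ivl a b)) - (∫ t, η t ∂(ivl a b)) * c := by
      rw [← integral_mul_const, ← integral_sub (bddint _ h1.continuous)
        ((hηi.restrict).mul_const c)]
      congr 1; ext t; simp; ring
    rw [e4, e2, ← e1, hz]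

/-- A function with an integrable weak derivative is a primitive of it. -/
lemma ftc {a b : ℝ} (hab : a < b) {u g : ℝ → ℝ} (hu : Integrable u (ivl a b))
    (hg : Integrable g (ivl a b)) (h : IsWeakDeriv a b 1 u g) :
    ∃ c : ℝ, u =ᵐ[ivl a b] fun x => c + ∫ s in a..x, g s := by
  have hgi := (ivl_intble hab g).2 hg
  have hGc : ContinuousOn (fun x => ∫ s in a..x, g s) (Icc a b) := by
    have := (hgi.absolutelyContinuousOnInterval_intervalIntegral (c := a) (by simp)).continuousOn
    rwa [uIcc_of_le hab.le] at this
  have hG : Integrable (fun x => ∫ s in a..x, g s) (ivl a b) :=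
    (hGc.integrableOn_Icc).mono_set Ioo_subset_Icc_self
  obtain ⟨c, hc⟩ := const_of_weak hab (hu.sub hG) (by
    intro η h1 h2 h3
    have e := h η h1 h2 h3
    have p := parts hab hg h1 0
    have za : η a = 0 := image_eq_zero_of_notMem_tsupport fun h => (h3 h).1.false
    have zb : η b = 0 := image_eq_zero_of_notMem_tsupport fun h => (h3 h).2.false
    have hd : Continuous (deriv η) := h1.continuous_deriv (by norm_cast)
    obtain ⟨C, hC⟩ := (isCompact_Icc (a := a) (b := b)).exists_bound_of_continuousOn hd.continuousOn
    have bd : ∀ w : ℝ → ℝ, Integrable w (ivl a b) →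
        Integrable (fun t => deriv η t * w t) (ivl a b) := by
      intro w hw
      refine hw.bdd_mul (c := C) hd.aestronglyMeasurable ?_
      filter_upwards [ae_restrict_mem measurableSet_Ioo] with t ht
      exact hC t (Ioo_subset_Icc_self ht)
    simp only [iteratedDeriv_one, smul_eq_mul, pow_one, neg_mul, one_mul] at e
    simp only [zero_add, za, zb, zero_mul, sub_self, zero_sub] at p
    simp only [Pi.sub_apply, mul_sub]
    rw [integral_sub (bd _ hu) (bd _ hG), e, p, sub_self])
  refine ⟨c, ?_⟩
  filter_upwards [hc] with x hx
  simp at hx; linarith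


lemma continuous_integral_smul {E : Type*} [NormedAddCommGroup E] [NormedSpace ℝ E]
    (a b : ℝ) {θ : ℝ → ℝ} (hθ : Continuous θ) :
    Continuous fun u : Lp E 2 (ivl a b) => ∫ t, θ t • u t ∂(ivl a b) := by
  obtain ⟨C, hC⟩ := (isCompact_Icc (a := a) (b := b)).exists_bound_of_continuousOn
    hθ.continuousOn
  refine AddMonoidHomClass.continuous_of_bound (AddMonoidHom.mk' _ fun u v => ?_)
    (|C| * ((ivl a b) univ ^ ((1 : ℝ) / 2)).toReal) fun u => ?_
  · rw [← integral_add (integrable_smul_of_Lp a b hθ _) (integrable_smul_of_Lp a b hθ _)]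
    apply integral_congr_ae
    filter_upwards [Lp.coeFn_add u v] with t ht
    rw [ht, Pi.add_apply, smul_add]
  · have hu : Integrable u (ivl a b) := (Lp.memLp u).integrable (by norm_num)
    have h1 : ‖∫ t, θ t • u t ∂(ivl a b)‖ ≤ ∫ t, |C| * ‖u t‖ ∂(ivl a b) := by
      refine (norm_integral_le_of_norm_le (hu.norm.const_mul _) ?_)
      filter_upwards [ae_restrict_mem measurableSet_Ioo] with t ht
      rw [norm_smul]
      gcongr
      exact (hC t (Ioo_subset_Icc_self ht)).trans (le_abs_self C)
    refine h1.trans ?_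
    rw [integral_const_mul, mul_assoc]
    gcongr
    have h2 := eLpNorm_le_eLpNorm_mul_rpow_measure_univ (μ := ivl a b) (p := 1) (q := 2)
      (by norm_num) (Lp.memLp u).aestronglyMeasurable
    rw [integral_norm_eq_lintegral_enorm hu.aestronglyMeasurable, ← eLpNorm_one_eq_lintegral_enorm,
      Lp.norm_def, mul_comm, ← ENNReal.toReal_mul]
    refine ENNReal.toReal_mono (ENNReal.mul_ne_top (Lp.eLpNorm_ne_top u) ?_) (h2.trans ?_)
    · exact ENNReal.rpow_ne_top_of_nonneg (by norm_num) (measure_ne_top _ _)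
    · norm_num

lemma isClosed_sobolev {E : Type*} [NormedAddCommGroup E] [NormedSpace ℝ E] (m : ℕ) (a b : ℝ) :
    IsClosed (sobolevSubmodule m a b E : Set (PiLp 2 fun _ : Fin (m + 1) => Lp E 2 (ivl a b))) := by
  have : (sobolevSubmodule m a b E : Set (PiLp 2 fun _ : Fin (m + 1) => Lp E 2 (ivl a b)))
      = ⋂ j : Fin (m + 1), ⋂ η : ℝ → ℝ, ⋂ _ : ContDiff ℝ ∞ η, ⋂ _ : HasCompactSupport η,
        ⋂ _ : tsupport η ⊆ Ioo a b, {U | ∫ t, iteratedDeriv j η t • U 0 t ∂(ivl a b)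
          = (-1 : ℝ) ^ (j : ℕ) • ∫ t, η t • U j t ∂(ivl a b)} := by
    ext U; simp [sobolevSubmodule, IsWeakDeriv]
  rw [this]
  refine isClosed_iInter fun j => isClosed_iInter fun η => isClosed_iInter fun h1 =>
    isClosed_iInter fun _ => isClosed_iInter fun _ => isClosed_eq ?_ ?_
  · exact (continuous_integral_smul a b (h1.continuous_iteratedDeriv j
      (by exact_mod_cast le_top))).comp (PiLp.continuous_apply 2 _ 0)
  · exact ((continuous_integral_smul a b h1.continuous).comp
      (PiLp.continuous_apply 2 _ j)).const_smul _

instance {E : Type*} [NormedAddCommGroup E] [NormedSpace ℝ E] [CompleteSpace E] (m : ℕ) (a b : ℝ) :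
    CompleteSpace (Sobolev m a b E) :=
  (isClosed_sobolev m a b).completeSpace_coe

lemma vanishes_iff {ℓ : ℝ} (hℓ : 0 < ℓ) (u : Sobolev 2 0 ℓ ℝ) :
    VanishesAtEnds 0 ℓ (u.d 0) ↔ ∀ ζ : ℝ → ℝ, ContDiff ℝ ∞ ζ →
      ∫ x, deriv ζ x • u.d 0 x ∂(ivl 0 ℓ) = - ∫ x, ζ x • u.d 1 x ∂(ivl 0 ℓ) := by
  have i0 : Integrable (u.d 0) (ivl 0 ℓ) := (Lp.memLp _).integrable (by norm_num)
  have i1 : Integrable (u.d 1) (ivl 0 ℓ) := (Lp.memLp _).integrable (by norm_num)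
  obtain ⟨c, hc⟩ := ftc hℓ i0 i1 (u.2 1)
  have hgi := (ivl_intble hℓ _).2 i1
  have hGc : ContinuousOn (fun x => c + ∫ s in (0 : ℝ)..x, u.d 1 s) (Icc 0 ℓ) := by
    have := (hgi.absolutelyContinuousOnInterval_intervalIntegral (c := 0) (by simp)).continuousOn
    rw [uIcc_of_le hℓ.le] at this
    exact continuousOn_const.add this
  have P : ∀ ζ : ℝ → ℝ, ContDiff ℝ ∞ ζ → ∫ x, deriv ζ x • u.d 0 x ∂(ivl 0 ℓ)
      = ζ ℓ * (c + ∫ s in (0 : ℝ)..ℓ, u.d 1 s) - ζ 0 * c - ∫ x, ζ x • u.d 1 x ∂(ivl 0 ℓ) := by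
    intro ζ hζ
    have p := parts hℓ i1 hζ c
    simp only [smul_eq_mul]
    rw [← p]
    apply integral_congr_ae
    filter_upwards [hc] with x hx
    rw [hx]
  constructor
  · rintro ⟨w, w1, w2, w3, w4⟩ ζ hζ
    have e : EqOn w (fun x => c + ∫ s in (0 : ℝ)..x, u.d 1 s) (Icc 0 ℓ) := by
      have h := w2.trans hc
      have h' : EqOn w (fun x => c + ∫ s in (0 : ℝ)..x, u.d 1 s) (Ioo 0 ℓ) :=
        Measure.eqOn_open_of_ae_eq (μ := volume) h isOpen_Ioo (w1.mono Ioo_subset_Icc_self)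
          (hGc.mono Ioo_subset_Icc_self)
      exact h'.of_subset_closure w1 hGc Ioo_subset_Icc_self (by rw [closure_Ioo hℓ.ne])
    have e0 := e (left_mem_Icc.2 hℓ.le)
    have e1 := e (right_mem_Icc.2 hℓ.le)
    simp only [w3, w4, intervalIntegral.integral_same, add_zero] at e0 e1
    rw [P ζ hζ, ← e1, ← e0]; simp
  · intro H
    have h1 := (P (fun _ => 1) contDiff_const).symm.trans (H _ contDiff_const)
    have h2 := (P (fun x => x) contDiff_id).symm.trans (H _ contDiff_id)
    have hl : c + ∫ s in (0 : ℝ)..ℓ, u.d 1 s = 0 := by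
      have : ℓ * (c + ∫ s in (0 : ℝ)..ℓ, u.d 1 s) = 0 := by linarith
      exact (mul_eq_zero.1 this).resolve_left hℓ.ne'
    have h0 : c = 0 := by linarith
    exact ⟨_, hGc, hc.symm, by simp [h0], hl⟩

/-- `H¹₀ ∩ H²` is complete, so the `H10H2 ℓ`-valued Bochner integrals above are the true ones. -/
lemma completeSpace_H10H2 {ℓ : ℝ} (hℓ : 0 < ℓ) : CompleteSpace (H10H2 ℓ) := by
  have hcl : IsClosed (h10h2Submodule ℓ : Set (Sobolev 2 0 ℓ ℝ)) := by
    have : (h10h2Submodule ℓ : Set (Sobolev 2 0 ℓ ℝ)) = ⋂ ζ : ℝ → ℝ, ⋂ _ : ContDiff ℝ ∞ ζ,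
        {u | ∫ x, deriv ζ x • u.d 0 x ∂(ivl 0 ℓ) = - ∫ x, ζ x • u.d 1 x ∂(ivl 0 ℓ)} := by
      ext u
      simp only [mem_iInter, mem_ofPred_eq]
      exact vanishes_iff hℓ u
    rw [this]
    refine isClosed_iInter fun ζ => isClosed_iInter fun hζ => isClosed_eq ?_ ?_
    · exact (continuous_integral_smul 0 ℓ (hζ.continuous_deriv (by norm_cast))).comp
        ((PiLp.continuous_apply 2 _ 0).comp continuous_subtype_val)
    · exact ((continuous_integral_smul 0 ℓ hζ.continuous).comp
        ((PiLp.continuous_apply 2 _ 1).comp continuous_subtype_val)).neg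
  exact hcl.completeSpace_coe

end Completeness

/-- The constants and the given functions of the inverse problem on `I = (0, ℓ)` and `(0, T)`. -/
structure Data (ℓ T : ℝ) where
  β : ℝ
  p : ℝ
  q : ℝ
  u₀ : Sobolev 4 0 ℓ ℝ
  u₁ : Sobolev 4 0 ℓ ℝ
  u₂ : Sobolev 2 0 ℓ ℝ
  φ : Sobolev 3 0 ℓ ℝ
  v₀ : H10H2 ℓ
  v₁ : H10H2 ℓ
  f : Sobolev 4 0 T ℝ

namespace Data

variable {ℓ T : ℝ} (D : Data ℓ T)

/-- `w = (1 - β d²/dx²)⁻¹ g`, i.e. `w ∈ H²(0, ℓ)` and `w - β w'' = g`. -/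
def IsResolvent (w : Sobolev 2 0 ℓ ℝ) (g : ℝ → ℝ) : Prop :=
  ∀ᵐ x ∂(ivl 0 ℓ), w.d 0 x - D.β * w.d 2 x = g x

/-- `∫₀^ℓ (φ - β φ'') g dx`. -/
def obs (g : ℝ → ℝ) : ℝ :=
  ∫ x in (0 : ℝ)..ℓ, (D.φ.d 0 x - D.β * D.φ.d 2 x) * g x

/-- `α`, where `α⁻¹ = ∫₀^ℓ φ' u₀'' dx`. -/
def α : ℝ := (∫ x in (0 : ℝ)..ℓ, D.φ.d 1 x * D.u₀.d 2 x)⁻¹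

/-- The value `k(0) = α (f'''(0) + ∫₀^ℓ v₀ φ''' dx)` of the kernel. -/
def k0 : ℝ :=
  D.α * (contRep 0 T (D.f.d 3) 0 + ∫ x in (0 : ℝ)..ℓ, D.v₀.dx 0 x * D.φ.d 3 x)

/-- `ψ(x) = ∫₀^x φ - β φ'(x)`. -/
def ψ (x : ℝ) : ℝ := (∫ s in (0 : ℝ)..x, D.φ.d 0 s) - D.β * contRep 0 ℓ (D.φ.d 1) x

/-- `φ ∈ H³₀(0, ℓ)` (that `u₀, u₁ ∈ H⁴(0, ℓ)` is part of their type). -/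
def I1 : Prop :=
  VanishesAtEnds 0 ℓ (D.φ.d 0) ∧ VanishesAtEnds 0 ℓ (D.φ.d 1) ∧ VanishesAtEnds 0 ℓ (D.φ.d 2)

/-- `u₂ = (1 - β d²/dx²)⁻¹ u₀''`, `v₀ = u₁ - u₁(ℓ) x/ℓ`, `v₁ = u₂ - u₂(ℓ) x/ℓ` (that
`v₀, v₁ ∈ H¹₀ ∩ H²` is part of their type). -/
def I2 : Prop :=
  D.IsResolvent D.u₂ (D.u₀.d 2) ∧
  (∀ᵐ x ∂(ivl 0 ℓ), D.v₀.dx 0 x = D.u₁.d 0 x - contRep 0 ℓ (D.u₁.d 0) ℓ * (x / ℓ)) ∧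
  (∀ᵐ x ∂(ivl 0 ℓ), D.v₁.dx 0 x = D.u₂.d 0 x - contRep 0 ℓ (D.u₂.d 0) ℓ * (x / ℓ))

def I3 : Prop := ∫ x in (0 : ℝ)..ℓ, D.φ.d 1 x * D.u₀.d 2 x ≠ 0

/-- The compatibility conditions for `f ∈ H⁴(0, T)` at `t = 0`. -/
def I4 : Prop :=
  D.obs (D.u₀.d 1) = contRep 0 T (D.f.d 0) 0 ∧
  D.obs (D.u₁.d 1) = contRep 0 T (D.f.d 1) 0 ∧
  D.obs (D.u₂.d 1) = contRep 0 T (D.f.d 2) 0 ∧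
  ∃ w : Sobolev 2 0 ℓ ℝ, D.IsResolvent w (fun x => D.u₁.d 3 x - D.k0 * D.u₀.d 3 x) ∧
    D.obs (w.d 0) = contRep 0 T (D.f.d 3) 0

/-- `ψ(ℓ) ≠ 0`, and `y''(0)` has the value compatible with the data. -/
def I5 {τ : ℝ} (y : Sobolev 3 0 τ ℝ) : Prop :=
  D.ψ ℓ ≠ 0 ∧
  contRep 0 τ (y.d 2) 0 = (D.ψ ℓ)⁻¹ *
    (contRep 0 T (D.f.d 1) 0 - D.k0 * contRep 0 T (D.f.d 0) 0
      + ∫ x in (0 : ℝ)..ℓ, D.ψ x * (D.u₁.d 2 x - D.k0 * D.u₀.d 2 x))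

/-- `z = p y' + q y`. -/
def z {τ : ℝ} (y : Sobolev 3 0 τ ℝ) (t : ℝ) : ℝ := D.p * y.d 1 t + D.q * y.d 0 t

/-- `z'' = p y''' + q y''`. -/
def ztt {τ : ℝ} (y : Sobolev 3 0 τ ℝ) (t : ℝ) : ℝ := D.p * y.d 3 t + D.q * y.d 2 t

/-- `(v, k, y)` solves the inverse problem on `(0, τ)`. The boundary conditions
`v|_{x=0} = v|_{x=ℓ} = 0` are part of the type of `v`. -/
structure IsSolution {τ : ℝ} (v : Sobolev 2 0 τ (H10H2 ℓ)) (k : Sobolev 1 0 τ ℝ)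
    (y : Sobolev 3 0 τ ℝ) : Prop where
  /-- `v_tt - v_xx - β v_xxtt + k(t) u₀'' + ∫₀^t k(t-s) v_xx(s) ds = z'' x/ℓ`. -/
  wave : ∀ᵐ t ∂(ivl 0 τ), ∀ᵐ x ∂(ivl 0 ℓ),
    (v.d 2 t).dx 0 x - (v.d 0 t).dx 2 x - D.β * (v.d 2 t).dx 2 x + k.d 0 t * D.u₀.d 2 x
      + (∫ s in (0 : ℝ)..t, k.d 0 (t - s) • (v.d 0 s).dx 2) x = D.ztt y t * (x / ℓ)
  /-- `[v_x - ∫₀^t k(t-s) v_x(s) ds]_{x=ℓ} = y'' + k(t) u₀'(ℓ) + (z - ∫₀^t k(t-s) z(s) ds)/ℓ`. -/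
  acoustic : ∀ᵐ t ∂(ivl 0 τ),
    (v.d 0 t).dxEnd - ∫ s in (0 : ℝ)..t, k.d 0 (t - s) * (v.d 0 s).dxEnd
      = y.d 2 t + k.d 0 t * contRep 0 ℓ (D.u₀.d 1) ℓ
        + (1 / ℓ) * (D.z y t - ∫ s in (0 : ℝ)..t, k.d 0 (t - s) * D.z y s)
  init : contRep 0 τ (v.d 0) 0 = D.v₀
  init_deriv : contRep 0 τ (v.d 1) 0 = D.v₁
  /-- `∫₀^ℓ (φ - β φ'') (v_x - z/ℓ) dx = f'(t)`. -/
  overdetermination : ∀ᵐ t ∂(ivl 0 τ),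
    D.obs (fun x => (v.d 0 t).dx 1 x - D.z y t / ℓ) = D.f.d 1 t

end Data

end MemoryKernel

end

noncomputable section

namespace MemoryKernel

/-! Let `V`, `K`, `Y` be the differences of two solutions `(v, k, y)`. The proof bounds all of them
by the time integral of their sizes and concludes with Gronwall's lemma.

The kernel is isolated by pairing the wave equation with `φ'`. Since `φ` and `φ'` vanish at the end
points, `⟨φ', w - βw''⟩ = -∫(φ - βφ'')w_x` and `⟨φ', x/ℓ⟩ = -ψ(ℓ)/ℓ` (`inner_φ_helmholtz`,
`inner_φ_ramp`). The overdetermination condition, differentiated twice in time, relates exactly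
these two quantities (`obs_sub`), so the terms with `v_tt` and `z''` cancel in the difference. What
remains is `K(t)∫φ'u₀''` in terms of `V(t)` and convolutions (`kernel_sub`), and (i3) permits
division.

The acoustic condition gives `Y''` in terms of `V`, `K`, `Y`, `Y'` and convolutions. In the wave
equation `Y'''` is merely integrable; one integration in time replaces it by `Y''`. The operator `1
- β d²/dx²` is bounded below from `H¹₀ ∩ H²` to `L²` (`le_norm_helmholtz`), so this controls `V'`,
and a second integration controls `V`. This argument is `eq_zero_of_memory_system`, stated for
abstract Banach spaces.

It needs zero initial values. Those of `V`, `V'` and `Y''` are prescribed; those of `Y'` and `Y`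
follow from the observation identity at `t = 0`, because `ψ(ℓ) ≠ 0` and `q ≠ 0` (`init_sub`). -/

lemma integrable_Lp {E : Type*} [NormedAddCommGroup E] {a b : ℝ}
    (u : Lp E 2 (ivl a b)) : Integrable u (ivl a b) :=
  (Lp.memLp u).integrable (by norm_num)

/-! ### Continuous representatives on a closed interval -/

lemma eqOn_Icc_of_ae {E : Type*} [NormedAddCommGroup E] {a b : ℝ} (hab : a < b) {w w' : ℝ → E}
    (h : w =ᵐ[ivl a b] w')
    (hw : ContinuousOn w (Icc a b)) (hw' : ContinuousOn w' (Icc a b)) : EqOn w w' (Icc a b) := by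
  have h' : EqOn w w' (Ioo a b) :=
    Measure.eqOn_open_of_ae_eq (μ := volume) h isOpen_Ioo (hw.mono Ioo_subset_Icc_self)
      (hw'.mono Ioo_subset_Icc_self)
  exact h'.of_subset_closure hw hw' Ioo_subset_Icc_self (by rw [closure_Ioo hab.ne])

lemma contRep_eq {E : Type*} [NormedAddCommGroup E] {a b : ℝ} (hab : a < b) {f w : ℝ → E}
    (hw : ContinuousOn w (Icc a b))
    (h : w =ᵐ[ivl a b] f) : EqOn (contRep a b f) w (Icc a b) := by
  have hex : ∃ w : ℝ → E, ContinuousOn w (Icc a b) ∧ w =ᵐ[ivl a b] f := ⟨w, hw, h⟩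
  rw [contRep, dif_pos hex]
  exact eqOn_Icc_of_ae hab (hex.choose_spec.2.trans h.symm) hex.choose_spec.1 hw

/-- The inequality means `max w w' = w'` almost everywhere, and an identity of continuous functions
extends to the closed interval. Estimates read off from almost-everywhere equations thus hold at
every time. -/
lemma le_on_Icc_of_ae {a b : ℝ} (hab : a < b) {w w' : ℝ → ℝ} (h : ∀ᵐ t ∂(ivl a b), w t ≤ w' t)
    (hw : Continuous w) (hw' : Continuous w') : ∀ t ∈ Icc a b, w t ≤ w' t := by
  have : EqOn (fun t => max (w t) (w' t)) w' (Icc a b) :=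
    eqOn_Icc_of_ae hab (by filter_upwards [h] with t ht; exact max_eq_right ht)
      (hw.max hw').continuousOn hw'.continuousOn
  intro t ht
  exact max_eq_right_iff.1 (this ht)

/-! ### Weak derivatives of Banach-valued functions -/

section WeakDerivatives

variable {E F : Type*} [NormedAddCommGroup E] [NormedSpace ℝ E]
  [NormedAddCommGroup F] [NormedSpace ℝ F]

lemma integrable_continuous_smul {a b : ℝ} {θ : ℝ → ℝ} (hθ : Continuous θ) {u : ℝ → E}
    (hu : Integrable u (ivl a b)) : Integrable (fun t => θ t • u t) (ivl a b) := by
  obtain ⟨C, hC⟩ := (isCompact_Icc (a := a) (b := b)).exists_bound_of_continuousOn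
    hθ.continuousOn
  refine hu.bdd_smul C hθ.aestronglyMeasurable ?_
  filter_upwards [ae_restrict_mem measurableSet_Ioo] with t ht
  exact hC t (Ioo_subset_Icc_self ht)

lemma ae_ivl_iff {a b : ℝ} {p : ℝ → Prop} :
    (∀ᵐ t ∂(ivl a b), p t) ↔ ∀ᵐ t, t ∈ Ioo a b → p t :=
  ae_restrict_iff' measurableSet_Ioo

lemma ae_eq_zero_of_test [CompleteSpace E] {a b : ℝ} {h : ℝ → E} (hh : Integrable h (ivl a b))
    (H : ∀ η : ℝ → ℝ, ContDiff ℝ ∞ η → HasCompactSupport η → tsupport η ⊆ Ioo a b →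
      ∫ t, η t • h t ∂(ivl a b) = 0) : h =ᵐ[ivl a b] 0 := by
  have main := (isOpen_Ioo (a := a) (b := b)).ae_eq_zero_of_integral_contDiff_smul_eq_zero
    (μ := volume) (f := h) (IntegrableOn.locallyIntegrableOn hh) (by
      intro η h1 h2 h3
      rw [← H η h1 h2 h3]
      symm
      apply setIntegral_eq_integral_of_forall_compl_eq_zero
      intro x hx
      rw [image_eq_zero_of_notMem_tsupport fun h => hx (h3 h), zero_smul])
  exact ae_ivl_iff.2 main

lemma IsWeakDeriv.unique [CompleteSpace E] {a b : ℝ} {j : ℕ} {u g g' : ℝ → E}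
    (hg : Integrable g (ivl a b)) (hg' : Integrable g' (ivl a b))
    (h : IsWeakDeriv a b j u g) (h' : IsWeakDeriv a b j u g') : g =ᵐ[ivl a b] g' := by
  have := ae_eq_zero_of_test (hg.sub hg') (by
    intro η h1 h2 h3
    simp only [Pi.sub_apply, smul_sub]
    rw [integral_sub (integrable_continuous_smul h1.continuous hg)
      (integrable_continuous_smul h1.continuous hg'), sub_eq_zero]
    have e := (h η h1 h2 h3).symm.trans (h' η h1 h2 h3)
    exact (smul_right_injective E (pow_ne_zero j (by norm_num : (-1 : ℝ) ≠ 0))) e)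
  filter_upwards [this] with t ht
  exact sub_eq_zero.1 ht

/-- If `u₁ = u⁽ⁱ⁾` and `u₂ = u⁽ⁱ⁺ʲ⁾` then `u₂ = u₁⁽ʲ⁾`. -/
lemma IsWeakDeriv.shift {a b : ℝ} {i j : ℕ} {u u₁ u₂ : ℝ → E}
    (h₁ : IsWeakDeriv a b i u u₁) (h₂ : IsWeakDeriv a b (i + j) u u₂) :
    IsWeakDeriv a b j u₁ u₂ := by
  intro η h1 h2 h3
  have c1 : ContDiff ℝ ∞ (iteratedDeriv j η) := by
    rw [iteratedDeriv_eq_iterate]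
    exact ContDiff.iterate_deriv j h1
  have s1 : tsupport (iteratedDeriv j η) ⊆ tsupport η := by
    rw [iteratedDeriv_eq_iterate]
    clear c1 h3 h2 h1 h₂
    induction j with
    | zero => simp
    | succ n ih =>
      rw [Function.iterate_succ_apply']
      exact (closure_minimal support_deriv_subset isClosed_closure).trans ih
  have e1 := h₁ _ c1 (HasCompactSupport.of_support_subset_isCompact h2 (subset_closure.trans s1))
    (s1.trans h3)
  have e2 := h₂ η h1 h2 h3
  have e3 : iteratedDeriv i (iteratedDeriv j η) = iteratedDeriv (i + j) η := by
    simp only [iteratedDeriv_eq_iterate, Function.iterate_add_apply]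
  rw [e3, e2, pow_add, mul_smul] at e1
  exact ((smul_right_injective E (pow_ne_zero i (by norm_num : (-1 : ℝ) ≠ 0))) e1).symm

lemma IsWeakDeriv.comp [CompleteSpace E] [CompleteSpace F] {a b : ℝ} {j : ℕ} {u g : ℝ → E}
    (hu : Integrable u (ivl a b)) (hg : Integrable g (ivl a b)) (h : IsWeakDeriv a b j u g)
    (L : E →L[ℝ] F) : IsWeakDeriv a b j (fun t => L (u t)) (fun t => L (g t)) := by
  intro η h1 h2 h3
  have hc : Continuous (iteratedDeriv j η) :=
    h1.continuous_iteratedDeriv j (by exact_mod_cast le_top)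
  have := congrArg L (h η h1 h2 h3)
  rw [L.map_smul, ← L.integral_comp_comm (integrable_continuous_smul hc hu),
    ← L.integral_comp_comm (integrable_continuous_smul h1.continuous hg)] at this
  simpa only [L.map_smul] using this

lemma IsWeakDeriv.add_smul {a b : ℝ} {j : ℕ} {u g u' g' : ℝ → E}
    (hu : Integrable u (ivl a b)) (hg : Integrable g (ivl a b))
    (hu' : Integrable u' (ivl a b)) (hg' : Integrable g' (ivl a b)) (h : IsWeakDeriv a b j u g)
    (h' : IsWeakDeriv a b j u' g') (c d : ℝ) :
    IsWeakDeriv a b j (fun t => c • u t + d • u' t) (fun t => c • g t + d • g' t) := by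
  intro η h1 h2 h3
  have hc : Continuous (iteratedDeriv j η) :=
    h1.continuous_iteratedDeriv j (by exact_mod_cast le_top)
  simp only [smul_add, smul_comm _ c, smul_comm _ d]
  rw [integral_add (f := fun t => c • iteratedDeriv j η t • u t)
      (g := fun t => d • iteratedDeriv j η t • u' t) ((integrable_continuous_smul hc hu).smul c)
      ((integrable_continuous_smul hc hu').smul d),
    integral_add (f := fun t => c • η t • g t) (g := fun t => d • η t • g' t)
      ((integrable_continuous_smul h1.continuous hg).smul c)
      ((integrable_continuous_smul h1.continuous hg').smul d),
    integral_smul, integral_smul, integral_smul, integral_smul, h η h1 h2 h3, h' η h1 h2 h3,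
    smul_add, smul_comm c, smul_comm d]

/-- The cut-off makes the primitive continuous on all of `ℝ` rather than only on `Icc a b`, so that
representatives can be chosen globally continuous. -/
lemma continuous_primitive_indicator {a b : ℝ} {g : ℝ → E} (hg : Integrable g (ivl a b)) :
    Continuous (fun t => ∫ s in a..t, (Ioo a b).indicator g s) :=
  ((integrable_indicator_iff measurableSet_Ioo).2 hg).continuous_primitive a

lemma integral_indicator_Ioo {a b t : ℝ} (ht : t ∈ Icc a b) (g : ℝ → E) :
    ∫ s in a..t, (Ioo a b).indicator g s = ∫ s in a..t, g s := by
  rw [intervalIntegral.integral_of_le ht.1, intervalIntegral.integral_of_le ht.1,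
    integral_Ioc_eq_integral_Ioo, integral_Ioc_eq_integral_Ioo]
  refine setIntegral_congr_fun measurableSet_Ioo fun s hs => ?_
  exact indicator_of_mem (s := Ioo a b) ⟨hs.1, hs.2.trans_le ht.2⟩ g

/-- A Banach-valued function with an integrable weak derivative has a continuous representative,
which is a primitive of the derivative. -/
lemma IsWeakDeriv.exists_continuous [CompleteSpace E] {a b : ℝ} (hab : a < b) {u g : ℝ → E}
    (hu : Integrable u (ivl a b)) (hg : Integrable g (ivl a b)) (h : IsWeakDeriv a b 1 u g) :
    ∃ w : ℝ → E, Continuous w ∧ w =ᵐ[ivl a b] u ∧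
      ∀ t ∈ Icc a b, w t = w a + ∫ s in a..t, g s := by
  set G : ℝ → E := fun t => ∫ s in a..t, (Ioo a b).indicator g s with hG
  have hGc : Continuous G := continuous_primitive_indicator hg
  have hGi : Integrable G (ivl a b) :=
    (hGc.continuousOn.integrableOn_Icc).mono_set Ioo_subset_Icc_self
  -- If `u - G` is constant, the constant must be its mean; the scalar case `ftc`, applied to `L ∘
  -- u` for each functional `L`, confirms this.
  set c : E := (b - a)⁻¹ • ∫ t, (u t - G t) ∂(ivl a b) with hc
  have hLG : ∀ (L : E →L[ℝ] ℝ), ∀ t ∈ Icc a b, L (G t) = ∫ s in a..t, L (g s) := by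
    intro L t ht
    simp only [hG]
    rw [integral_indicator_Ioo ht, L.intervalIntegral_comp_comm]
    rw [intervalIntegrable_iff_integrableOn_Ioo_of_le ht.1]
    exact IntegrableOn.mono_set hg (Ioo_subset_Ioo_right ht.2)
  have hL : ∀ L : E →L[ℝ] ℝ, (fun t => L (u t - G t)) =ᵐ[ivl a b] fun _ => L c := by
    intro L
    obtain ⟨d, hd⟩ := ftc hab (L.integrable_comp hu) (L.integrable_comp hg) (h.comp hu hg L)
    have e : (fun t => L (u t - G t)) =ᵐ[ivl a b] fun _ => d := by
      filter_upwards [hd, ae_restrict_mem measurableSet_Ioo] with t ht ht'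
      rw [map_sub, ht, hLG L t (Ioo_subset_Icc_self ht')]
      simp
    have : L c = d := by
      rw [hc, L.map_smul, ← L.integral_comp_comm (φ := fun t => u t - G t) (hu.sub hGi),
        integral_congr_ae e]
      simp [hab.le]
      field_simp [(sub_pos.2 hab).ne']
    rwa [this]
  have hz := ae_eq_zero_of_test (h := fun t => u t - G t - c)
    ((hu.sub hGi).sub (integrable_const c)) (by
      intro η h1 h2 h3
      -- The null set in `hL` depends on `L`, so functionals are applied to the tested integrals and
      -- not pointwise in `t`.
      refine SeparatingDual.eq_zero_of_forall_dual_eq_zero (R := ℝ) fun L => ?_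
      rw [← ContinuousLinearMap.integral_comp_comm L
        (φ := fun t => η t • (u t - G t - c)) (integrable_continuous_smul h1.continuous
        ((hu.sub hGi).sub (integrable_const c)))]
      rw [integral_congr_ae (g := fun _ => 0), integral_zero]
      filter_upwards [hL L] with t ht
      rw [L.map_smul, map_sub, ht, sub_self, smul_zero])
  refine ⟨fun t => c + G t, by fun_prop, ?_, ?_⟩
  · filter_upwards [hz] with t ht
    have : u t - G t - c = 0 := ht
    rw [sub_sub, sub_eq_zero] at this
    rw [this, add_comm]
  · intro t ht
    simp only [hG, intervalIntegral.integral_same, add_zero]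
    rw [integral_indicator_Ioo ht]

namespace Sobolev

variable {m : ℕ} {a b : ℝ}

lemma isWeakDeriv (u : Sobolev m a b E) (j : Fin (m + 1)) : IsWeakDeriv a b j (u.d 0) (u.d j) :=
  u.2 j

lemma isWeakDeriv_shift (u : Sobolev m a b E) (i : Fin (m + 1)) (j : ℕ) (k : Fin (m + 1))
    (h : (k : ℕ) = i + j) : IsWeakDeriv a b j (u.d i) (u.d k) :=
  (u.isWeakDeriv i).shift (by have := u.isWeakDeriv k; rwa [h] at this)

lemma d_sub (u v : Sobolev m a b E) (j : Fin (m + 1)) : (u - v).d j = u.d j - v.d j := rfl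

/-- The higher components are weak derivatives of the zeroth one, hence determined by it. -/
lemma eq_of_d_zero [CompleteSpace E] {u v : Sobolev m a b E}
    (h : u.d 0 =ᵐ[ivl a b] v.d 0) : u = v := by
  apply Subtype.ext
  apply PiLp.ext
  intro j
  apply Lp.ext
  exact (u.isWeakDeriv j).unique (integrable_Lp _) (integrable_Lp _)
    ((v.isWeakDeriv j).congr h EventuallyEq.rfl)

end Sobolev

end WeakDerivatives

/-! ### Integration by parts and the inner product of `L²(0, ℓ)` -/

/-- Integration by parts for primitives of integrable functions. -/
lemma integral_mul_of_primitive {a b : ℝ} (hab : a < b) {u g w h : ℝ → ℝ}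
    (hg : Integrable g (ivl a b)) (hh : Integrable h (ivl a b)) {c d : ℝ}
    (hu : u =ᵐ[ivl a b] fun x => c + ∫ s in a..x, g s)
    (hw : w =ᵐ[ivl a b] fun x => d + ∫ s in a..x, h s)
    (ha : c = 0) (hb : c + ∫ s in a..b, g s = 0) :
    ∫ x, u x * h x ∂(ivl a b) = - ∫ x, g x * w x ∂(ivl a b) := by
  have hgi := (ivl_intble hab g).2 hg
  have hhi := (ivl_intble hab h).2 hh
  have hc : ∀ c : ℝ, AbsolutelyContinuousOnInterval (fun _ : ℝ => c) a b := fun c =>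
    (contDiff_const.contDiffOn).absolutelyContinuousOnInterval
  have hU : AbsolutelyContinuousOnInterval (fun x => c + ∫ s in a..x, g s) a b :=
    (hc c).add (hgi.absolutelyContinuousOnInterval_intervalIntegral (c := a) (by simp))
  have hW : AbsolutelyContinuousOnInterval (fun x => d + ∫ s in a..x, h s) a b :=
    (hc d).add (hhi.absolutelyContinuousOnInterval_intervalIntegral (c := a) (by simp))
  have key := hU.integral_mul_deriv_eq_deriv_mul hW
  have e1 : ∫ x in a..b, (c + ∫ s in a..x, g s) * deriv (fun x => d + ∫ s in a..x, h s) x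
      = ∫ x in a..b, (c + ∫ s in a..x, g s) * h x := by
    apply intervalIntegral.integral_congr_ae
    filter_upwards [hhi.ae_hasDerivAt_integral] with x hx hx2
    have := hx (uIoc_subset_uIcc hx2) a (by simp)
    rw [(this.const_add d).deriv]
  have e2 : ∫ x in a..b, deriv (fun x => c + ∫ s in a..x, g s) x * (d + ∫ s in a..x, h s)
      = ∫ x in a..b, g x * (d + ∫ s in a..x, h s) := by
    apply intervalIntegral.integral_congr_ae
    filter_upwards [hgi.ae_hasDerivAt_integral] with x hx hx2
    have := hx (uIoc_subset_uIcc hx2) a (by simp)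
    rw [(this.const_add c).deriv]
  rw [e1, e2, hb, ← ivl_int hab, ← ivl_int hab] at key
  have e3 : ∫ x, u x * h x ∂(ivl a b) = ∫ x, (c + ∫ s in a..x, g s) * h x ∂(ivl a b) :=
    integral_congr_ae (hu.mul (EventuallyEq.refl _ h))
  have e4 : ∫ x, g x * w x ∂(ivl a b) = ∫ x, g x * (d + ∫ s in a..x, h s) ∂(ivl a b) :=
    integral_congr_ae ((EventuallyEq.refl _ g).mul hw)
  rw [e3, key, e4, intervalIntegral.integral_same, ha, ← ivl_int hab]
  simp

/-- Integration by parts for Sobolev functions, one of which vanishes at the end points. -/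
lemma VanishesAtEnds.integral_mul {a b : ℝ} (hab : a < b) {u g w h : ℝ → ℝ} {d : ℝ}
    (hv : VanishesAtEnds a b u) (hu : Integrable u (ivl a b))
    (hg : Integrable g (ivl a b)) (hh : Integrable h (ivl a b))
    (hug : IsWeakDeriv a b 1 u g) (hw : w =ᵐ[ivl a b] fun x => d + ∫ s in a..x, h s) :
    ∫ x, u x * h x ∂(ivl a b) = - ∫ x, g x * w x ∂(ivl a b) := by
  obtain ⟨U, hU1, hU2, hU3⟩ := hug.exists_continuous hab hu hg
  obtain ⟨U', h1, h2, h3, h4⟩ := hv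
  have e := eqOn_Icc_of_ae hab (h2.trans hU2.symm) h1 hU1.continuousOn
  have ea := e (left_mem_Icc.2 hab.le)
  have eb := e (right_mem_Icc.2 hab.le)
  refine integral_mul_of_primitive hab hg hh (c := U a) ?_ hw (by rw [← ea, h3])
    (by rw [← hU3 b (right_mem_Icc.2 hab.le), ← eb, h4])
  filter_upwards [hU2, ae_restrict_mem measurableSet_Ioo] with x hx hx'
  rw [← hx, hU3 x (Ioo_subset_Icc_self hx')]

lemma inner_L2 {ℓ : ℝ} (f g : Lp ℝ 2 (ivl 0 ℓ)) :
    inner ℝ f g = ∫ x, f x * g x ∂(ivl 0 ℓ) := by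
  rw [L2.inner_def]
  simp [mul_comm]

lemma memLp_continuous {ℓ : ℝ} {θ : ℝ → ℝ} (hθ : Continuous θ) : MemLp θ 2 (ivl 0 ℓ) := by
  obtain ⟨C, hC⟩ := (isCompact_Icc (a := 0) (b := ℓ)).exists_bound_of_continuousOn
    hθ.continuousOn
  refine MemLp.of_bound hθ.aestronglyMeasurable C ?_
  filter_upwards [ae_restrict_mem measurableSet_Ioo] with t ht
  exact hC t (Ioo_subset_Icc_self ht)

/-- A continuous function as an element of `L²(0, ℓ)`. -/
def contL2 (ℓ : ℝ) (θ : ℝ → ℝ) (hθ : Continuous θ) : Lp ℝ 2 (ivl 0 ℓ) :=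
  (memLp_continuous hθ).toLp θ

lemma coeFn_contL2 {ℓ : ℝ} {θ : ℝ → ℝ} (hθ : Continuous θ) :
    contL2 ℓ θ hθ =ᵐ[ivl 0 ℓ] θ := MemLp.coeFn_toLp _

/-! ### Bounded operators on `H¹₀ ∩ H²` -/

namespace H10H2

variable {ℓ : ℝ}

lemma norm_sq (w : H10H2 ℓ) : ‖w‖ ^ 2 = ‖w.dx 0‖ ^ 2 + ‖w.dx 1‖ ^ 2 + ‖w.dx 2‖ ^ 2 := by
  have : ‖w‖ ^ 2 = ∑ j : Fin 3, ‖w.dx j‖ ^ 2 := PiLp.norm_sq_eq_of_L2 _ _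
  rw [this, Fin.sum_univ_three]

/-- `w ↦ ∂ʲw` as a bounded operator. -/
def dxL (ℓ : ℝ) (j : Fin 3) : H10H2 ℓ →L[ℝ] Lp ℝ 2 (ivl 0 ℓ) :=
  LinearMap.mkContinuous ⟨⟨fun w => w.dx j, fun _ _ => rfl⟩, fun _ _ => rfl⟩ 1 fun w => by
    rw [one_mul]
    exact PiLp.norm_apply_le (w.1 : Sobolev 2 0 ℓ ℝ).1 j

lemma dxL_apply (j : Fin 3) (w : H10H2 ℓ) : dxL ℓ j w = w.dx j := rfl

lemma vanishes (w : H10H2 ℓ) : VanishesAtEnds 0 ℓ (w.dx 0) := w.2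

lemma weak01 (w : H10H2 ℓ) : IsWeakDeriv 0 ℓ 1 (w.dx 0) (w.dx 1) := w.1.isWeakDeriv 1

lemma weak12 (w : H10H2 ℓ) : IsWeakDeriv 0 ℓ 1 (w.dx 1) (w.dx 2) :=
  Sobolev.isWeakDeriv_shift (w.1 : Sobolev 2 0 ℓ ℝ) 1 1 2 rfl

/-- The boundary terms vanish because `w` does at both ends; nothing is required of `w_x` there. -/
lemma inner_dx_zero_two (hℓ : 0 < ℓ) (w : H10H2 ℓ) :
    inner ℝ (w.dx 0) (w.dx 2) = - ‖w.dx 1‖ ^ 2 := by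
  obtain ⟨d, hd⟩ := ftc hℓ (integrable_Lp _) (integrable_Lp _) w.weak12
  rw [inner_L2, w.vanishes.integral_mul hℓ (integrable_Lp _) (integrable_Lp _) (integrable_Lp _)
    w.weak01 hd, ← real_inner_self_eq_norm_sq, inner_L2]

/-- The operator `1 - β d²/dx²` on `H¹₀ ∩ H²`. -/
def helmholtz (ℓ β : ℝ) : H10H2 ℓ →L[ℝ] Lp ℝ 2 (ivl 0 ℓ) := dxL ℓ 0 - β • dxL ℓ 2

lemma helmholtz_apply (β : ℝ) (w : H10H2 ℓ) : helmholtz ℓ β w = w.dx 0 - β • w.dx 2 := rfl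

/-- By `inner_dx_zero_two` the cross term in the expanded square is `2β‖w_x‖² ≥ 0`. The three
squares therefore carry the coefficients `1`, `2β`, `β²`, each at least `(min 1 β)²`. -/
lemma le_norm_helmholtz (hℓ : 0 < ℓ) {β : ℝ} (hβ : 0 < β) (w : H10H2 ℓ) :
    min 1 β * ‖w‖ ≤ ‖helmholtz ℓ β w‖ := by
  refine le_of_sq_le_sq ?_ (norm_nonneg _)
  have h1 : ‖helmholtz ℓ β w‖ ^ 2
      = ‖w.dx 0‖ ^ 2 + 2 * β * ‖w.dx 1‖ ^ 2 + β ^ 2 * ‖w.dx 2‖ ^ 2 := by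
    rw [helmholtz_apply, norm_sub_sq_real, inner_smul_right, inner_dx_zero_two hℓ, norm_smul,
      mul_pow, Real.norm_eq_abs, sq_abs]
    ring
  have c1 : min 1 β ≤ 1 := min_le_left _ _
  have c2 : min 1 β ≤ β := min_le_right _ _
  have c0 : 0 < min 1 β := lt_min one_pos hβ
  set c := min 1 β
  rw [h1, mul_pow, norm_sq]
  have e1 : c ^ 2 ≤ 1 := pow_le_one₀ c0.le c1
  have e2 : c ^ 2 ≤ 2 * β := by nlinarith
  have e3 : c ^ 2 ≤ β ^ 2 := by gcongr
  have := mul_le_mul_of_nonneg_right e1 (sq_nonneg ‖w.dx 0‖)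
  have := mul_le_mul_of_nonneg_right e2 (sq_nonneg ‖w.dx 1‖)
  have := mul_le_mul_of_nonneg_right e3 (sq_nonneg ‖w.dx 2‖)
  linarith

/-- `w ↦ w_x(ℓ)` as a bounded functional, through `ℓ w_x(ℓ) = ∫₀^ℓ (w_x + x w_xx)`. -/
def dxEndL (ℓ : ℝ) : H10H2 ℓ →L[ℝ] ℝ :=
  ℓ⁻¹ • (innerSL ℝ (contL2 ℓ (fun _ => 1) continuous_const) ∘L dxL ℓ 1
    + innerSL ℝ (contL2 ℓ (fun x => x) continuous_id) ∘L dxL ℓ 2)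

lemma dxEndL_apply (hℓ : 0 < ℓ) (w : H10H2 ℓ) : dxEndL ℓ w = w.dxEnd := by
  obtain ⟨W, h1, h2, h3⟩ := w.weak12.exists_continuous hℓ (integrable_Lp _) (integrable_Lp _)
  have hr := right_mem_Icc.2 hℓ.le
  rw [dxEnd, contRep_eq hℓ h1.continuousOn h2 hr, h3 ℓ hr]
  -- With `η = id` the boundary term at `0` drops out and the one at `ℓ` is `ℓ w_x(ℓ)`.
  have p := parts hℓ (integrable_Lp (w.dx 2)) contDiff_id (W 0)
  have e1 : ∫ x, contL2 ℓ (fun _ => 1) continuous_const x * w.dx 1 x ∂(ivl 0 ℓ)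
      = ∫ x, deriv id x * (W 0 + ∫ s in (0 : ℝ)..x, w.dx 2 s) ∂(ivl 0 ℓ) := by
    apply integral_congr_ae
    filter_upwards [h2, coeFn_contL2 (ℓ := ℓ) (θ := fun _ => 1) continuous_const,
      ae_restrict_mem measurableSet_Ioo] with x hx hx1 hx2
    rw [hx1, ← hx, h3 x (Ioo_subset_Icc_self hx2), deriv_id]
  have e2 : ∫ x, contL2 ℓ (fun x => x) continuous_id x * w.dx 2 x ∂(ivl 0 ℓ)
      = ∫ x, id x * w.dx 2 x ∂(ivl 0 ℓ) := by
    apply integral_congr_ae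
    filter_upwards [coeFn_contL2 (ℓ := ℓ) (θ := fun x => x) continuous_id] with x hx
    rw [hx, id]
  simp only [dxEndL, smul_apply, add_apply,
    ContinuousLinearMap.comp_apply, innerSL_apply_apply, dxL_apply, inner_L2, smul_eq_mul]
  rw [e1, e2, p]
  simp only [id]
  field_simp
  ring

end H10H2

/-! ### Pairings with `φ'` and the observation functional -/

namespace Data

variable {ℓ T : ℝ} (D : Data ℓ T)

/-- `φ - β φ''` as an element of `L²(0, ℓ)`. -/
def weight : Lp ℝ 2 (ivl 0 ℓ) := D.φ.d 0 - D.β • D.φ.d 2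

lemma coeFn_weight : D.weight =ᵐ[ivl 0 ℓ] fun x => D.φ.d 0 x - D.β * D.φ.d 2 x := by
  filter_upwards [Lp.coeFn_sub (D.φ.d 0) (D.β • D.φ.d 2), Lp.coeFn_smul D.β (D.φ.d 2)] with x h h'
  rw [weight, h, Pi.sub_apply, h', Pi.smul_apply, smul_eq_mul]

/-- `w ↦ ∫₀^ℓ (φ - β φ'') w_x dx` as a bounded functional. -/
def obsL : H10H2 ℓ →L[ℝ] ℝ := innerSL ℝ D.weight ∘L H10H2.dxL ℓ 1

/-- `x/ℓ` as an element of `L²(0, ℓ)`. -/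
def ramp (ℓ : ℝ) : Lp ℝ 2 (ivl 0 ℓ) := contL2 ℓ (fun x => x / ℓ) (by fun_prop)

lemma φ_weak (i k : Fin 4) (h : (k : ℕ) = i + 1) : IsWeakDeriv 0 ℓ 1 (D.φ.d i) (D.φ.d k) :=
  D.φ.isWeakDeriv_shift i 1 k h

/-- One integration by parts in each term: `∫φ'w = -∫φw_x` uses the zeros of `φ`, and `∫φ'w_xx =
-∫φ''w_x` those of `φ'`. Testing the wave equation with `φ'` thus produces the observed quantity. -/
lemma inner_φ_helmholtz (hℓ : 0 < ℓ) (h1 : D.I1) (w : H10H2 ℓ) :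
    inner ℝ (D.φ.d 1) (H10H2.helmholtz ℓ D.β w) = - D.obsL w := by
  obtain ⟨c, hc⟩ := ftc hℓ (integrable_Lp _) (integrable_Lp _) w.weak01
  obtain ⟨d, hd⟩ := ftc hℓ (integrable_Lp _) (integrable_Lp _) w.weak12
  have e1 := h1.1.integral_mul hℓ (integrable_Lp _) (integrable_Lp _) (integrable_Lp _)
    (D.φ_weak 0 1 rfl) hc
  have e2 := h1.2.1.integral_mul hℓ (integrable_Lp _) (integrable_Lp _) (integrable_Lp _)
    (D.φ_weak 1 2 rfl) hd
  rw [← inner_L2, ← inner_L2] at e1 e2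
  rw [H10H2.helmholtz_apply, inner_sub_right, inner_smul_right, e2, obsL,
    ContinuousLinearMap.comp_apply, innerSL_apply_apply, H10H2.dxL_apply, weight, inner_sub_left,
    real_inner_smul_left, e1]
  ring

lemma ψ_end (hℓ : 0 < ℓ) (h1 : D.I1) : D.ψ ℓ = ∫ x, D.φ.d 0 x ∂(ivl 0 ℓ) := by
  obtain ⟨W, hW, hW', -, hz⟩ := h1.2.1
  rw [ψ, contRep_eq hℓ hW hW' (right_mem_Icc.2 hℓ.le), hz, ivl_int hℓ]
  ring

lemma inner_φ_ramp (hℓ : 0 < ℓ) (h1 : D.I1) : inner ℝ (D.φ.d 1) (ramp ℓ) = - (D.ψ ℓ / ℓ) := by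
  have e := h1.1.integral_mul hℓ (w := fun x => x) (h := fun _ => 1) (d := 0) (integrable_Lp _)
    (integrable_Lp _) (integrable_const _) (D.φ_weak 0 1 rfl)
    (ae_of_all _ fun x => by simp)
  simp only [mul_one] at e
  rw [D.ψ_end hℓ h1, e, inner_L2, neg_div, neg_neg, ← integral_div]
  apply integral_congr_ae
  filter_upwards [coeFn_contL2 (ℓ := ℓ) (θ := fun x => x / ℓ) (by fun_prop)] with x hx
  rw [ramp, hx, mul_div_assoc]

/-- The term `φ''` integrates to zero because `φ'` vanishes at both ends. The same `ψ(ℓ)` appears in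
`inner_φ_ramp`, which is why `z''` later cancels. -/
lemma integral_weight (hℓ : 0 < ℓ) (h1 : D.I1) :
    ∫ x, (D.φ.d 0 x - D.β * D.φ.d 2 x) ∂(ivl 0 ℓ) = D.ψ ℓ := by
  have e := h1.2.1.integral_mul hℓ (w := fun _ => 1) (h := fun _ => 0) (d := 1) (integrable_Lp _)
    (integrable_Lp _) (integrable_const _) (D.φ_weak 1 2 rfl)
    (ae_of_all _ fun x => by simp)
  simp only [mul_zero, integral_zero, mul_one] at e
  rw [integral_sub (integrable_Lp _) ((integrable_Lp _).const_mul _), integral_const_mul,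
    D.ψ_end hℓ h1]
  linear_combination (-D.β) * e

lemma obs_sub_const (hℓ : 0 < ℓ) (h1 : D.I1) (w : H10H2 ℓ) (c : ℝ) :
    D.obs (fun x => w.dx 1 x - c) = D.obsL w - c * D.ψ ℓ := by
  have i1 : Integrable (fun x => D.weight x * w.dx 1 x) (ivl 0 ℓ) := by
    have := L2.integrable_inner (𝕜 := ℝ) (w.dx 1) D.weight
    simpa using this
  have i2 : Integrable (fun x => (D.φ.d 0 x - D.β * D.φ.d 2 x) * c) (ivl 0 ℓ) :=
    ((integrable_Lp _).sub ((integrable_Lp _).const_mul _)).mul_const c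
  rw [obs, ← ivl_int hℓ, obsL, ContinuousLinearMap.comp_apply, innerSL_apply_apply, inner_L2,
    ← D.integral_weight hℓ h1, mul_comm c, ← integral_mul_const, H10H2.dxL_apply,
    ← integral_sub i1 i2]
  apply integral_congr_ae
  filter_upwards [D.coeFn_weight] with x hx
  rw [hx, mul_sub]

end Data

/-! ### Convolution estimates and Gronwall's lemma -/

/-- The convolution `∫₀ᵗ k(t-s) w(s) ds`. -/
def conv {F : Type*} [NormedAddCommGroup F] [NormedSpace ℝ F] (k : ℝ → ℝ) (w : ℝ → F) (t : ℝ) : F :=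
  ∫ s in (0 : ℝ)..t, k (t - s) • w s

/-- Split as `k₁*w₁ - k₂*w₂ = (k₁ - k₂)*w₁ + k₂*(w₁ - w₂)`. The constant depends on bounds for `w₁`
and `k₂`, which is harmless for uniqueness, and the reflection `s ↦ t - s` makes both terms
multiples of `∫₀ᵗ n`. -/
lemma norm_conv_sub_conv_le {F : Type*} [NormedAddCommGroup F] [NormedSpace ℝ F] {τ : ℝ}
    {n : ℝ → ℝ} (hn : Continuous n) {k₁ k₂ : ℝ → ℝ} {w₁ w₂ : ℝ → F}
    (hk₁ : Continuous k₁) (hk₂ : Continuous k₂) (hw₁ : Continuous w₁) (hw₂ : Continuous w₂)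
    {c : ℝ} (hk : ∀ t ∈ Icc 0 τ, |k₁ t - k₂ t| ≤ n t)
    (hw : ∀ t ∈ Icc 0 τ, ‖w₁ t - w₂ t‖ ≤ c * n t) :
    ∃ C, ∀ t ∈ Icc 0 τ, ‖conv k₁ w₁ t - conv k₂ w₂ t‖ ≤ C * ∫ s in (0 : ℝ)..t, n s := by
  obtain ⟨M, hM⟩ := (isCompact_Icc (a := (0 : ℝ)) (b := τ)).exists_bound_of_continuousOn
    hw₁.continuousOn
  obtain ⟨N, hN⟩ := (isCompact_Icc (a := (0 : ℝ)) (b := τ)).exists_bound_of_continuousOn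
    hk₂.continuousOn
  refine ⟨M + N * c, fun t ht => ?_⟩
  have e : conv k₁ w₁ t - conv k₂ w₂ t
      = ∫ s in (0 : ℝ)..t, ((k₁ (t - s) - k₂ (t - s)) • w₁ s + k₂ (t - s) • (w₁ s - w₂ s)) := by
    rw [conv, conv, ← intervalIntegral.integral_sub]
    · congr 1; ext s; rw [sub_smul, smul_sub]; abel
    · exact Continuous.intervalIntegrable (by fun_prop) _ _
    · exact Continuous.intervalIntegrable (by fun_prop) _ _
  have e2 : ∫ s in (0 : ℝ)..t, n (t - s) = ∫ s in (0 : ℝ)..t, n s := by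
    rw [intervalIntegral.integral_comp_sub_left n t]; simp
  have e3 : ∫ s in (0 : ℝ)..t, (M * n (t - s) + N * c * n s)
      = (M + N * c) * ∫ s in (0 : ℝ)..t, n s := by
    rw [intervalIntegral.integral_add, intervalIntegral.integral_const_mul,
      intervalIntegral.integral_const_mul, e2, add_mul]
    · exact Continuous.intervalIntegrable (by fun_prop) _ _
    · exact Continuous.intervalIntegrable (by fun_prop) _ _
  rw [e, ← e3]
  refine intervalIntegral.norm_integral_le_of_norm_le ht.1 (ae_of_all _ fun s hs => ?_)
    (Continuous.intervalIntegrable (by fun_prop) _ _)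
  have hs' : s ∈ Icc 0 τ := ⟨hs.1.le, hs.2.trans ht.2⟩
  have hts : t - s ∈ Icc 0 τ := ⟨by linarith [hs.2], by linarith [hs.1, ht.2]⟩
  refine (norm_add_le _ _).trans ?_
  rw [norm_smul, norm_smul, mul_comm M, mul_assoc N, Real.norm_eq_abs]
  have h1 := hk _ hts
  have h2 := hM _ hs'
  have h3 := hN _ hts
  have h4 := hw _ hs'
  gcongr
  · exact (abs_nonneg _).trans h1
  · exact (norm_nonneg _).trans h3

/-- Gronwall's inequality is applied to the primitive of `n`, whose derivative is `n` and whose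
initial value is `0`. -/
lemma eq_zero_of_le_integral {τ C : ℝ} {n : ℝ → ℝ} (hn : Continuous n) (h0 : ∀ t, 0 ≤ n t)
    (h : ∀ t ∈ Icc 0 τ, n t ≤ C * ∫ s in (0 : ℝ)..t, n s) : ∀ t ∈ Icc 0 τ, n t = 0 := by
  have hd : ∀ t, HasDerivAt (fun t => ∫ s in (0 : ℝ)..t, n s) (n t) t := fun t =>
    intervalIntegral.integral_hasDerivAt_right (hn.intervalIntegrable _ _)
      (hn.stronglyMeasurableAtFilter _ _) hn.continuousAt
  have key := norm_le_gronwallBound_of_norm_deriv_right_le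
    (f := fun t => ∫ s in (0 : ℝ)..t, n s) (f' := n) (δ := 0) (K := C) (ε := 0) (a := 0) (b := τ)
    (fun t _ => (hd t).continuousAt.continuousWithinAt) (fun t _ => (hd t).hasDerivWithinAt)
    (by simp) (fun t ht => by
      rw [Real.norm_of_nonneg (h0 t), add_zero, Real.norm_of_nonneg
        (intervalIntegral.integral_nonneg ht.1 fun s _ => h0 s)]
      exact h t (Ico_subset_Icc_self ht))
  intro t ht
  have hI : ∫ s in (0 : ℝ)..t, n s = 0 := by
    have := key t ht
    rw [gronwallBound_ε0_δ0] at this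
    exact norm_le_zero_iff.1 this
  have := h t ht
  rw [hI, mul_zero] at this
  exact le_antisymm this (h0 t)

lemma intervalIntegrable_of_ivl {F : Type*} [NormedAddCommGroup F] {τ t : ℝ} {w : ℝ → F}
    (hw : Integrable w (ivl 0 τ)) (ht : t ∈ Icc 0 τ) : IntervalIntegrable w volume 0 t := by
  rw [intervalIntegrable_iff_integrableOn_Ioo_of_le ht.1]
  exact IntegrableOn.mono_set hw (Ioo_subset_Ioo_right ht.2)

/-! ### The abstract system with memory -/

/-- Two solutions of a second order equation with memory, coupled to an equation for the kernel and
to a boundary condition of acoustic type, coincide if their initial values do. -/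
theorem eq_zero_of_memory_system {E H : Type*} [NormedAddCommGroup E] [NormedSpace ℝ E]
    [CompleteSpace E] [NormedAddCommGroup H] [NormedSpace ℝ H] [CompleteSpace H]
    {τ c p q γ a r : ℝ} (hτ : 0 < τ) (hc : 0 < c) (hγ : γ ≠ 0)
    (A B : E →L[ℝ] H) (e : E →L[ℝ] ℝ) (P : H →L[ℝ] ℝ) (g ξ : H)
    (hA : ∀ w, c * ‖w‖ ≤ ‖A w‖)
    {v₁ v₂ V' V'' : ℝ → E} {k₁ k₂ z₁ z₂ Y Y' Y'' Y''' : ℝ → ℝ}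
    (hv₁ : Continuous v₁) (hv₂ : Continuous v₂) (hk₁ : Continuous k₁)
    (hk₂ : Continuous k₂) (hz₁ : Continuous z₁) (hz₂ : Continuous z₂) (hY : Continuous Y)
    (hY' : Continuous Y') (hY'' : Continuous Y'') (hV''i : Integrable V'' (ivl 0 τ))
    (hY'''i : Integrable Y''' (ivl 0 τ))
    (dV : ∀ t ∈ Icc 0 τ, v₁ t - v₂ t = ∫ s in (0 : ℝ)..t, V' s)
    (dV' : ∀ t ∈ Icc 0 τ, V' t = ∫ s in (0 : ℝ)..t, V'' s)
    (dY : ∀ t ∈ Icc 0 τ, Y t = ∫ s in (0 : ℝ)..t, Y' s)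
    (dY' : ∀ t ∈ Icc 0 τ, Y' t = ∫ s in (0 : ℝ)..t, Y'' s)
    (dY'' : ∀ t ∈ Icc 0 τ, Y'' t = ∫ s in (0 : ℝ)..t, Y''' s)
    (hz : ∀ t ∈ Icc 0 τ, z₁ t - z₂ t = p * Y' t + q * Y t)
    (wave : ∀ᵐ t ∂(ivl 0 τ), A (V'' t) - B (v₁ t - v₂ t) + (k₁ t - k₂ t) • g
      + (conv k₁ (fun s => B (v₁ s)) t - conv k₂ (fun s => B (v₂ s)) t)
      = (p * Y''' t + q * Y'' t) • ξ)
    (kernel : ∀ᵐ t ∂(ivl 0 τ), (k₁ t - k₂ t) * γ = P (B (v₁ t - v₂ t))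
      - P (conv k₁ (fun s => B (v₁ s)) t - conv k₂ (fun s => B (v₂ s)) t))
    (acoustic : ∀ᵐ t ∂(ivl 0 τ), e (v₁ t - v₂ t)
      - (conv k₁ (fun s => e (v₁ s)) t - conv k₂ (fun s => e (v₂ s)) t)
      = Y'' t + (k₁ t - k₂ t) * a + r * (z₁ t - z₂ t - (conv k₁ z₁ t - conv k₂ z₂ t))) :
    ∀ t ∈ Icc 0 τ, v₁ t = v₂ t ∧ k₁ t = k₂ t ∧ Y t = 0 := by
  -- `V'` need not enter, since it is bounded below by `n` and its integral; `Y'''` cannot enter,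
  -- since it is only integrable.
  set n : ℝ → ℝ := fun t => ‖v₁ t - v₂ t‖ + |k₁ t - k₂ t| + |Y t| + |Y' t| + |Y'' t| with hn
  set I : ℝ → ℝ := fun t => ∫ s in (0 : ℝ)..t, n s with hI
  have hnc : Continuous n := by fun_prop
  have hn0 : ∀ t, 0 ≤ n t := fun t => by positivity
  have hIc : Continuous I := intervalIntegral.continuous_primitive
    (fun a b => hnc.intervalIntegrable a b) 0
  have hI0 : ∀ t ∈ Icc 0 τ, 0 ≤ I t := fun t ht =>
    intervalIntegral.integral_nonneg ht.1 fun s _ => hn0 s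
  have nV : ∀ t, ‖v₁ t - v₂ t‖ ≤ n t := fun t => by
    simp only [hn]; linarith [abs_nonneg (k₁ t - k₂ t), abs_nonneg (Y t), abs_nonneg (Y' t),
      abs_nonneg (Y'' t)]
  have nK : ∀ t, |k₁ t - k₂ t| ≤ n t := fun t => by
    simp only [hn]; linarith [norm_nonneg (v₁ t - v₂ t), abs_nonneg (Y t), abs_nonneg (Y' t),
      abs_nonneg (Y'' t)]
  have nY' : ∀ t, |Y' t| ≤ n t := fun t => by
    simp only [hn]; linarith [norm_nonneg (v₁ t - v₂ t), abs_nonneg (Y t),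
      abs_nonneg (k₁ t - k₂ t), abs_nonneg (Y'' t)]
  have nY : ∀ t, |Y t| ≤ n t := fun t => by
    simp only [hn]; linarith [norm_nonneg (v₁ t - v₂ t), abs_nonneg (Y' t),
      abs_nonneg (k₁ t - k₂ t), abs_nonneg (Y'' t)]
  have nY'' : ∀ t, |Y'' t| ≤ n t := fun t => by
    simp only [hn]; linarith [norm_nonneg (v₁ t - v₂ t), abs_nonneg (Y' t),
      abs_nonneg (k₁ t - k₂ t), abs_nonneg (Y t)]
  have bound : ∀ w : ℝ → ℝ, (∀ t, |w t| ≤ n t) →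
      ∀ t ∈ Icc 0 τ, |∫ s in (0 : ℝ)..t, w s| ≤ I t := fun w h t ht => by
    rw [← Real.norm_eq_abs]
    exact intervalIntegral.norm_integral_le_of_norm_le ht.1 (ae_of_all _ fun s _ => h s)
      (hnc.intervalIntegrable _ _)
  have bY : ∀ t ∈ Icc 0 τ, |Y t| ≤ I t := fun t ht => by
    rw [dY t ht]; exact bound Y' nY' t ht
  have bY' : ∀ t ∈ Icc 0 τ, |Y' t| ≤ I t := fun t ht => by
    rw [dY' t ht]; exact bound Y'' nY'' t ht
  have bZ : ∀ t ∈ Icc 0 τ, |z₁ t - z₂ t| ≤ (|p| + |q|) * I t := fun t ht => by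
    rw [hz t ht]
    refine (abs_add_le _ _).trans ?_
    rw [abs_mul, abs_mul, add_mul]
    gcongr
    · exact bY' t ht
    · exact bY t ht
  have nZ : ∀ t ∈ Icc 0 τ, ‖z₁ t - z₂ t‖ ≤ (|p| + |q|) * n t := fun t ht => by
    rw [hz t ht, Real.norm_eq_abs]
    refine (abs_add_le _ _).trans ?_
    rw [abs_mul, abs_mul, add_mul]
    gcongr
    · exact nY' t
    · exact nY t
  obtain ⟨C₁, hC₁⟩ := norm_conv_sub_conv_le hnc hk₁ hk₂ (B.continuous.comp hv₁)
    (B.continuous.comp hv₂) (c := ‖B‖) (fun t _ => nK t) (fun t _ => by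
      simp only [Function.comp_apply]
      rw [← map_sub]
      exact (B.le_opNorm _).trans (by gcongr; exact nV t))
  obtain ⟨C₂, hC₂⟩ := norm_conv_sub_conv_le hnc hk₁ hk₂ (e.continuous.comp hv₁)
    (e.continuous.comp hv₂) (c := ‖e‖) (fun t _ => nK t) (fun t _ => by
      simp only [Function.comp_apply]
      rw [← map_sub]
      exact (e.le_opNorm _).trans (by gcongr; exact nV t))
  obtain ⟨C₃, hC₃⟩ := norm_conv_sub_conv_le hnc hk₁ hk₂ hz₁ hz₂ (fun t _ => nK t) nZ
  -- The term with `Y'''` stays on the left, as it has no pointwise bound.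
  have aux : ∀ᵐ t, t ∈ Ioo 0 τ → ‖A (V'' t) - (p * Y''' t + q * Y'' t) • ξ‖
      ≤ (‖B‖ + ‖g‖) * n t + |C₁| * I t := by
    filter_upwards [ae_ivl_iff.1 wave] with t h ht
    have ht' := Ioo_subset_Icc_self ht
    rw [← h ht, show ∀ x y z w : H, x - (x - y + z + w) = y - z - w from fun x y z w => by abel]
    refine (norm_sub_le _ _).trans (add_le_add ((norm_sub_le _ _).trans ?_) ?_)
    · rw [add_mul, norm_smul, mul_comm ‖g‖]
      gcongr
      · exact (B.le_opNorm _).trans (by gcongr; exact nV t)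
      · exact nK t
    · refine (hC₁ t ht').trans ?_
      exact mul_le_mul_of_nonneg_right (le_abs_self _) (hI0 t ht')
  -- Integration in time turns `p Y''' + q Y''` into `p Y'' + q Y'`, by the zero initial values. The
  -- factor `τ` comes from integrating the constant bound `I t`.
  have bAV : ∀ t ∈ Icc 0 τ, ‖A (V' t) - (p * Y'' t + q * Y' t) • ξ‖
      ≤ (‖B‖ + ‖g‖ + |C₁| * τ) * I t := by
    intro t ht
    have e1 : A (V' t) - (p * Y'' t + q * Y' t) • ξ
        = ∫ s in (0 : ℝ)..t, (A (V'' s) - (p * Y''' s + q * Y'' s) • ξ) := by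
      have i1 : IntervalIntegrable (fun s => p * Y''' s) volume 0 t := 
        (intervalIntegrable_of_ivl hY'''i ht).const_mul p
      have i2 : IntervalIntegrable (fun s => q * Y'' s) volume 0 t :=
        Continuous.intervalIntegrable (by fun_prop) _ _
      rw [intervalIntegral.integral_sub,
        A.intervalIntegral_comp_comm (intervalIntegrable_of_ivl hV''i ht), ← dV' t ht,
        intervalIntegral.integral_smul_const, intervalIntegral.integral_add i1 i2,
        intervalIntegral.integral_const_mul, intervalIntegral.integral_const_mul, ← dY' t ht,
        ← dY'' t ht]
      · exact intervalIntegrable_of_ivl (A.integrable_comp hV''i) ht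
      · have := (i1.add i2)
        rw [intervalIntegrable_iff] at this ⊢
        exact this.smul_const ξ
    rw [e1]
    have e2 : ∫ s in (0 : ℝ)..t, ((‖B‖ + ‖g‖) * n s + |C₁| * I t)
        = (‖B‖ + ‖g‖) * I t + |C₁| * t * I t := by
      rw [intervalIntegral.integral_add (Continuous.intervalIntegrable (by fun_prop) _ _)
        (Continuous.intervalIntegrable (by fun_prop) _ _), intervalIntegral.integral_const_mul,
        intervalIntegral.integral_const]
      simp only [sub_zero, smul_eq_mul, hI]
      ring
    have e3 : (‖B‖ + ‖g‖) * I t + |C₁| * t * I t ≤ (‖B‖ + ‖g‖ + |C₁| * τ) * I t := by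
      rw [add_mul _ (|C₁| * τ)]
      have := hI0 t ht
      have := ht.2
      gcongr
    refine le_trans ?_ (e2.le.trans e3)
    refine intervalIntegral.norm_integral_le_of_norm_le ht.1 ?_
      (Continuous.intervalIntegrable (by fun_prop) _ _)
    -- The equation is known only on the open interval, so the possible end point `s = τ` is
    -- discarded.
    filter_upwards [aux, Measure.ae_ne volume τ] with s hs hne hs'
    have hsτ : s ∈ Ioo 0 τ := ⟨hs'.1, lt_of_le_of_ne (hs'.2.trans ht.2) hne⟩
    refine (hs hsτ).trans ?_
    gcongr
    simp only [hI]
    exact intervalIntegral.integral_mono_interval le_rfl hs'.1.le hs'.2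
      (ae_of_all _ hn0) (hnc.intervalIntegrable _ _)
  obtain ⟨C₄, hC₄⟩ : ∃ C, ∀ t ∈ Icc 0 τ, ‖v₁ t - v₂ t‖ ≤ C * I t := by
    set D := ‖B‖ + ‖g‖ + |C₁| * τ with hD
    have hD0 : 0 ≤ D := by positivity
    set M := (|p| + |q|) * ‖ξ‖ with hM
    -- The lower bound `hA` recovers `V'` from `A V'`. The term `M * n t` is not yet an integral,
    -- because `Y''` and `Y'` enter pointwise; integrating `V'` to `V` repairs this.
    have hVn : ∀ t ∈ Icc 0 τ, ‖V' t‖ ≤ c⁻¹ * (D * I t + M * n t) := by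
      intro t ht
      rw [inv_mul_eq_div, le_div_iff₀' hc]
      refine (hA _).trans ?_
      rw [← sub_add_cancel (A (V' t)) ((p * Y'' t + q * Y' t) • ξ)]
      refine (norm_add_le _ _).trans (add_le_add (bAV t ht) ?_)
      rw [norm_smul, hM, mul_right_comm]
      gcongr
      rw [Real.norm_eq_abs, add_mul]
      refine (abs_add_le _ _).trans ?_
      rw [abs_mul, abs_mul]
      gcongr
      · exact nY'' t
      · exact nY' t
    refine ⟨c⁻¹ * (D * τ + M), fun t ht => ?_⟩
    have e2 : ∫ s in (0 : ℝ)..t, c⁻¹ * (D * I t + M * n s) = c⁻¹ * (D * t * I t + M * I t) := by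
      rw [intervalIntegral.integral_const_mul, intervalIntegral.integral_add
        (Continuous.intervalIntegrable (by fun_prop) _ _)
        (Continuous.intervalIntegrable (by fun_prop) _ _),
        intervalIntegral.integral_const_mul M, intervalIntegral.integral_const]
      simp only [sub_zero, smul_eq_mul, hI]
      ring
    have e3 : c⁻¹ * (D * t * I t + M * I t) ≤ c⁻¹ * (D * τ + M) * I t := by
      rw [mul_assoc c⁻¹, add_mul (D * τ)]
      have := hI0 t ht
      have := ht.2
      gcongr
    rw [dV t ht]
    refine le_trans ?_ (e2.le.trans e3)
    refine intervalIntegral.norm_integral_le_of_norm_le ht.1 (ae_of_all _ fun s hs => ?_)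
      (Continuous.intervalIntegrable (by fun_prop) _ _)
    refine (hVn s ⟨hs.1.le, hs.2.trans ht.2⟩).trans ?_
    gcongr
    simp only [hI]
    exact intervalIntegral.integral_mono_interval le_rfl hs.1.le hs.2
      (ae_of_all _ hn0) (hnc.intervalIntegrable _ _)
  -- The kernel equation contains no time derivative of `V`, so the bound on `V` just obtained
  -- suffices.
  obtain ⟨C₅, hC₅⟩ : ∃ C, ∀ t ∈ Icc 0 τ, |k₁ t - k₂ t| ≤ C * I t := by
    refine ⟨|γ|⁻¹ * (‖P‖ * (‖B‖ * C₄) + ‖P‖ * C₁),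
      le_on_Icc_of_ae hτ ?_ (by fun_prop) (by fun_prop)⟩
    filter_upwards [kernel, ae_restrict_mem measurableSet_Ioo] with t h ht
    have ht' := Ioo_subset_Icc_self ht
    rw [mul_assoc, inv_mul_eq_div, le_div_iff₀ (abs_pos.2 hγ), ← abs_mul, h]
    refine (abs_sub _ _).trans ?_
    rw [add_mul, mul_assoc, mul_assoc, mul_assoc]
    refine add_le_add ((P.le_opNorm _).trans ?_) ((P.le_opNorm _).trans ?_)
    · gcongr
      refine (B.le_opNorm _).trans ?_
      gcongr
      exact hC₄ t ht'
    · gcongr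
      exact hC₁ t ht'
  -- Solve the acoustic condition for `Y''`: every other term is already bounded by a multiple of
  -- `I`.
  obtain ⟨C₆, hC₆⟩ : ∃ C, ∀ t ∈ Icc 0 τ, |Y'' t| ≤ C * I t := by
    refine ⟨‖e‖ * C₄ + C₂ + |a| * C₅ + |r| * (|p| + |q| + C₃),
      le_on_Icc_of_ae hτ ?_ (by fun_prop) (by fun_prop)⟩
    filter_upwards [acoustic, ae_restrict_mem measurableSet_Ioo] with t h ht
    have ht' := Ioo_subset_Icc_self ht
    have h1 : |e (v₁ t - v₂ t)| ≤ ‖e‖ * (C₄ * I t) :=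
      (e.le_opNorm _).trans (by gcongr; exact hC₄ t ht')
    have h2 : |conv k₁ (fun s => e (v₁ s)) t - conv k₂ (fun s => e (v₂ s)) t| ≤ C₂ * I t :=
      hC₂ t ht'
    have h3 : |(k₁ t - k₂ t) * a| ≤ |a| * (C₅ * I t) := by
      rw [abs_mul, mul_comm]; gcongr; exact hC₅ t ht'
    have h4 : |r * (z₁ t - z₂ t - (conv k₁ z₁ t - conv k₂ z₂ t))|
        ≤ |r| * ((|p| + |q|) * I t + C₃ * I t) := by
      rw [abs_mul]; gcongr
      exact (abs_sub _ _).trans (add_le_add (bZ t ht') (hC₃ t ht'))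
    have h5 : Y'' t = e (v₁ t - v₂ t)
        - (conv k₁ (fun s => e (v₁ s)) t - conv k₂ (fun s => e (v₂ s)) t)
        - (k₁ t - k₂ t) * a - r * (z₁ t - z₂ t - (conv k₁ z₁ t - conv k₂ z₂ t)) := by
      rw [h]; ring
    rw [h5]
    refine (abs_sub _ _).trans ((add_le_add ((abs_sub _ _).trans
      (add_le_add ((abs_sub _ _).trans (add_le_add h1 h2)) h3)) h4).trans_eq ?_)
    ring
  -- The two summands `1` account for `Y` and `Y'`, which are primitives of functions bounded by
  -- `n`.
  have hn_zero := eq_zero_of_le_integral (τ := τ) (C := C₄ + C₅ + 1 + 1 + C₆) hnc hn0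
    fun t ht => by
      have := hC₄ t ht
      have := hC₅ t ht
      have := hC₆ t ht
      have := bY t ht
      have := bY' t ht
      change n t ≤ _ * I t
      simp only [hn]
      linarith
  intro t ht
  have h0 := hn_zero t ht
  refine ⟨sub_eq_zero.1 (norm_le_zero_iff.1 ((nV t).trans h0.le)),
    sub_eq_zero.1 (abs_nonpos_iff.1 ((nK t).trans h0.le)), abs_nonpos_iff.1 ((nY t).trans h0.le)⟩

/-! ### Passage from function classes to continuous representatives -/

lemma integral_congr_ivl {F : Type*} [NormedAddCommGroup F] [NormedSpace ℝ F] {τ t : ℝ}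
    {f g : ℝ → F} (h : f =ᵐ[ivl 0 τ] g) (ht : t ∈ Icc 0 τ) :
    ∫ s in (0 : ℝ)..t, f s = ∫ s in (0 : ℝ)..t, g s := by
  rw [intervalIntegral.integral_of_le ht.1, intervalIntegral.integral_of_le ht.1,
    integral_Ioc_eq_integral_Ioo, integral_Ioc_eq_integral_Ioo]
  exact integral_congr_ae (ae_restrict_of_ae_restrict_of_subset (Ioo_subset_Ioo_right ht.2) h)

/-- The reflection `s ↦ t - s` preserves null sets and maps `(0, t)` into `(0, τ)`, so altering `k`
on a null set is invisible at every `t`, not just almost every `t`. -/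
lemma conv_congr {F : Type*} [NormedAddCommGroup F] [NormedSpace ℝ F] {τ t : ℝ}
    {k k' : ℝ → ℝ} {w w' : ℝ → F} (hk : k =ᵐ[ivl 0 τ] k') (hw : w =ᵐ[ivl 0 τ] w')
    (ht : t ∈ Icc 0 τ) : conv k w t = conv k' w' t := by
  rw [conv, conv, intervalIntegral.integral_of_le ht.1, intervalIntegral.integral_of_le ht.1,
    integral_Ioc_eq_integral_Ioo, integral_Ioc_eq_integral_Ioo]
  refine setIntegral_congr_ae measurableSet_Ioo ?_
  have hk' := (Measure.measurePreserving_sub_left volume t).quasiMeasurePreserving.ae (ae_ivl_iff.1 hk)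
  filter_upwards [hk', ae_ivl_iff.1 hw] with s h1 h2 hs
  rw [h1 ⟨by linarith [hs.2], by linarith [hs.1, ht.2]⟩, h2 ⟨hs.1, hs.2.trans_le ht.2⟩]

lemma conv_comp_congr {F G : Type*} [NormedAddCommGroup F] [NormedSpace ℝ F] [NormedAddCommGroup G]
    [NormedSpace ℝ G] (L : F →L[ℝ] G) {τ t : ℝ} {k k' : ℝ → ℝ} {w w' : ℝ → F}
    (hk : k =ᵐ[ivl 0 τ] k') (hw : w =ᵐ[ivl 0 τ] w') (ht : t ∈ Icc 0 τ) :
    conv k (fun s => L (w s)) t = conv k' (fun s => L (w' s)) t :=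
  conv_congr hk (hw.fun_comp L) ht

namespace Sobolev

variable {E : Type*} [NormedAddCommGroup E] [NormedSpace ℝ E] [CompleteSpace E] {m : ℕ} {a b : ℝ}

lemma exists_continuous (hab : a < b) (u : Sobolev m a b E) (i k : Fin (m + 1))
    (h : (k : ℕ) = i + 1) :
    ∃ w : ℝ → E, Continuous w ∧ w =ᵐ[ivl a b] u.d i ∧ contRep a b (u.d i) a = w a ∧
      ∀ t ∈ Icc a b, w t = w a + ∫ s in a..t, u.d k s := by
  obtain ⟨w, h1, h2, h3⟩ := (u.isWeakDeriv_shift i 1 k h).exists_continuous hab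
    (integrable_Lp _) (integrable_Lp _)
  exact ⟨w, h1, h2, contRep_eq hab h1.continuousOn h2 (left_mem_Icc.2 hab.le), h3⟩

lemma contRep_d_sub (hab : a < b) (u v : Sobolev m a b E) (i k : Fin (m + 1))
    (h : (k : ℕ) = i + 1) :
    contRep a b ((u - v).d i) a = contRep a b (u.d i) a - contRep a b (v.d i) a := by
  obtain ⟨w, h1, h2, h3, -⟩ := u.exists_continuous hab i k h
  obtain ⟨w', h1', h2', h3', -⟩ := v.exists_continuous hab i k h
  rw [h3, h3']
  refine contRep_eq hab (w := fun t => w t - w' t) (h1.sub h1').continuousOn ?_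
    (left_mem_Icc.2 hab.le)
  rw [d_sub]
  filter_upwards [h2, h2', Lp.coeFn_sub (u.d i) (v.d i)] with t e e' e''
  rw [e, e', e'', Pi.sub_apply]

end Sobolev

/-! ### The equations of a solution in operator form -/

namespace Data

variable {ℓ T τ : ℝ} {D : Data ℓ T} {v : Sobolev 2 0 τ (H10H2 ℓ)} {k : Sobolev 1 0 τ ℝ}
  {y : Sobolev 3 0 τ ℝ}

namespace IsSolution

lemma wave_L2 (h : D.IsSolution v k y) : ∀ᵐ t ∂(ivl 0 τ),
    H10H2.helmholtz ℓ D.β (v.d 2 t) - H10H2.dxL ℓ 2 (v.d 0 t) + k.d 0 t • D.u₀.d 2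
      + conv (k.d 0) (fun s => H10H2.dxL ℓ 2 (v.d 0 s)) t = D.ztt y t • ramp ℓ := by
  filter_upwards [h.wave] with t ht
  simp only [H10H2.helmholtz_apply, H10H2.dxL_apply, conv]
  set C := ∫ s in (0 : ℝ)..t, k.d 0 (t - s) • (v.d 0 s).dx 2
  apply Lp.ext
  filter_upwards [ht, Lp.coeFn_add ((v.d 2 t).dx 0 - D.β • (v.d 2 t).dx 2 - (v.d 0 t).dx 2
      + k.d 0 t • D.u₀.d 2) C,
    Lp.coeFn_add ((v.d 2 t).dx 0 - D.β • (v.d 2 t).dx 2 - (v.d 0 t).dx 2) (k.d 0 t • D.u₀.d 2),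
    Lp.coeFn_sub ((v.d 2 t).dx 0 - D.β • (v.d 2 t).dx 2) ((v.d 0 t).dx 2),
    Lp.coeFn_sub ((v.d 2 t).dx 0) (D.β • (v.d 2 t).dx 2), Lp.coeFn_smul D.β ((v.d 2 t).dx 2),
    Lp.coeFn_smul (k.d 0 t) (D.u₀.d 2), Lp.coeFn_smul (D.ztt y t) (ramp ℓ),
    coeFn_contL2 (ℓ := ℓ) (θ := fun x => x / ℓ) (by fun_prop)]
    with x h0 h1 h2 h3 h4 h5 h6 h7 h8
  rw [h1, Pi.add_apply, h2, Pi.add_apply, h3, Pi.sub_apply, h4, Pi.sub_apply, h5, Pi.smul_apply,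
    h6, Pi.smul_apply, h7, Pi.smul_apply, ramp, h8, smul_eq_mul, smul_eq_mul, smul_eq_mul, ← h0]
  ring

lemma acoustic_L (hℓ : 0 < ℓ) (h : D.IsSolution v k y) : ∀ᵐ t ∂(ivl 0 τ),
    H10H2.dxEndL ℓ (v.d 0 t) - conv (k.d 0) (fun s => H10H2.dxEndL ℓ (v.d 0 s)) t
      = y.d 2 t + k.d 0 t * contRep 0 ℓ (D.u₀.d 1) ℓ
        + (1 / ℓ) * (D.z y t - conv (k.d 0) (D.z y) t) := by
  simpa only [H10H2.dxEndL_apply hℓ, conv, smul_eq_mul] using h.acoustic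

lemma obs_L (hℓ : 0 < ℓ) (h1 : D.I1) (h : D.IsSolution v k y) : ∀ᵐ t ∂(ivl 0 τ),
    D.obsL (v.d 0 t) - D.z y t / ℓ * D.ψ ℓ = D.f.d 1 t := by
  simpa only [D.obs_sub_const hℓ h1] using h.overdetermination

/-- The observation of the difference of two solutions, and its time derivatives. -/
lemma obs_sub (hℓ : 0 < ℓ) (h1 : D.I1) {v' : Sobolev 2 0 τ (H10H2 ℓ)} {k' : Sobolev 1 0 τ ℝ}
    {y' : Sobolev 3 0 τ ℝ} (h : D.IsSolution v k y) (h' : D.IsSolution v' k' y') (j : Fin 3) :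
    ∀ᵐ t ∂(ivl 0 τ), D.obsL ((v - v').d j t)
      = D.ψ ℓ / ℓ * (D.p * (y - y').d j.succ t + D.q * (y - y').d j.castSucc t) := by
  have := completeSpace_H10H2 hℓ
  -- The datum `f'` cancels in the difference.
  have e0 : (fun t => D.obsL ((v - v').d 0 t)) =ᵐ[ivl 0 τ] fun t =>
      (D.ψ ℓ / ℓ * D.p) • (y - y').d 1 t + (D.ψ ℓ / ℓ * D.q) • (y - y').d 0 t := by
    simp only [Sobolev.d_sub]
    filter_upwards [h.obs_L hℓ h1, h'.obs_L hℓ h1, Lp.coeFn_sub (v.d 0) (v'.d 0),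
      Lp.coeFn_sub (y.d 0) (y'.d 0), Lp.coeFn_sub (y.d 1) (y'.d 1)] with t a1 a2 a3 a4 a5
    rw [a3, a4, a5]
    simp only [Pi.sub_apply, map_sub, smul_eq_mul]
    simp only [z] at a1 a2
    linear_combination a1 - a2
  -- Both sides of `e0` are differentiated `j` times in the weak sense. Since `z` involves `y'` and
  -- `y ∈ H³`, orders up to `2` are available, and weak derivatives are unique.
  have w1 := ((v - v').isWeakDeriv j).comp (integrable_Lp _) (integrable_Lp _) D.obsL
  have w2 := ((y - y').isWeakDeriv_shift 1 j j.succ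
    (by simp [add_comm])).add_smul
    (integrable_Lp _) (integrable_Lp _) (integrable_Lp _) (integrable_Lp _)
    ((y - y').isWeakDeriv_shift 0 j j.castSucc (by simp)) (D.ψ ℓ / ℓ * D.p)
    (D.ψ ℓ / ℓ * D.q)
  have u := w1.unique (D.obsL.integrable_comp (integrable_Lp _))
    (((integrable_Lp _).smul (D.ψ ℓ / ℓ * D.p)).add ((integrable_Lp _).smul (D.ψ ℓ / ℓ * D.q)))
    (w2.congr e0 EventuallyEq.rfl)
  filter_upwards [u] with t ht
  rw [ht]
  simp only [Pi.add_apply, Pi.smul_apply, smul_eq_mul]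
  ring

end IsSolution

end Data

/-! ### Differences of solutions and uniqueness -/

namespace Data.IsSolution

variable {ℓ T τ : ℝ} {D : Data ℓ T} {v v' : Sobolev 2 0 τ (H10H2 ℓ)} {k k' : Sobolev 1 0 τ ℝ}
  {y y' : Sobolev 3 0 τ ℝ}

/-- The equation for the difference of the kernels of two solutions: the wave equation tested
with `φ'`. -/
lemma kernel_sub (hℓ : 0 < ℓ) (h1 : D.I1) (h : D.IsSolution v k y) (h' : D.IsSolution v' k' y') :
    ∀ᵐ t ∂(ivl 0 τ), (k.d 0 t - k'.d 0 t) * inner ℝ (D.φ.d 1) (D.u₀.d 2)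
      = inner ℝ (D.φ.d 1) (H10H2.dxL ℓ 2 (v.d 0 t - v'.d 0 t))
        - inner ℝ (D.φ.d 1) (conv (k.d 0) (fun s => H10H2.dxL ℓ 2 (v.d 0 s)) t
          - conv (k'.d 0) (fun s => H10H2.dxL ℓ 2 (v'.d 0 s)) t) := by
  filter_upwards [h.wave_L2, h'.wave_L2, h.obs_sub hℓ h1 h' 2, Lp.coeFn_sub (v.d 2) (v'.d 2),
    Lp.coeFn_sub (y.d 3) (y'.d 3), Lp.coeFn_sub (y.d 2) (y'.d 2)] with t a a' b e2 f3 f2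
  -- After pairing with `φ'`, the terms `v_tt - βv_xxtt` and `z'' x/ℓ` contribute precisely the two
  -- sides of this identity, and hence cancel.
  have b' : D.obsL (v.d 2 t) - D.obsL (v'.d 2 t)
      = D.ψ ℓ / ℓ * (D.ztt y t - D.ztt y' t) := by
    change D.obsL ((v - v').d 2 t)
      = D.ψ ℓ / ℓ * (D.p * (y - y').d 3 t + D.q * (y - y').d 2 t) at b
    rw [Sobolev.d_sub, Sobolev.d_sub, Sobolev.d_sub, e2, f3, f2] at b
    simp only [Pi.sub_apply, map_sub] at b
    rw [b, ztt, ztt]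
    ring
  have i := congrArg (inner ℝ (D.φ.d 1)) a
  have i' := congrArg (inner ℝ (D.φ.d 1)) a'
  rw [inner_add_right, inner_add_right, inner_sub_right, D.inner_φ_helmholtz hℓ h1,
    real_inner_smul_right, real_inner_smul_right, D.inner_φ_ramp hℓ h1] at i i'
  rw [map_sub, inner_sub_right, inner_sub_right]
  linear_combination i - i' + b'

/-- The initial values of the difference of two solutions vanish. -/
lemma init_sub (hℓ : 0 < ℓ) (hτ : 0 < τ) (hq : 0 < D.q) (h1 : D.I1) (h : D.IsSolution v k y)
    (h' : D.IsSolution v' k' y') (h5 : D.I5 y) (h5' : D.I5 y') :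
    contRep 0 τ ((v - v').d 0) 0 = 0 ∧ contRep 0 τ ((v - v').d 1) 0 = 0 ∧
    contRep 0 τ ((y - y').d 0) 0 = 0 ∧ contRep 0 τ ((y - y').d 1) 0 = 0 ∧
    contRep 0 τ ((y - y').d 2) 0 = 0 := by
  have := completeSpace_H10H2 hℓ
  have hv0 : contRep 0 τ ((v - v').d 0) 0 = 0 := by
    rw [Sobolev.contRep_d_sub hτ v v' 0 1 rfl, h.init, h'.init, sub_self]
  have hv1 : contRep 0 τ ((v - v').d 1) 0 = 0 := by
    rw [Sobolev.contRep_d_sub hτ v v' 1 2 rfl, h.init_deriv, h'.init_deriv, sub_self]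
  have hy2 : contRep 0 τ ((y - y').d 2) 0 = 0 := by
    rw [Sobolev.contRep_d_sub hτ y y' 2 3 rfl, h5.2, h5'.2, sub_self]
  -- The observation identity of order `i`, evaluated at `t = 0` through continuous representatives,
  -- with the nonzero factor `ψ(ℓ)/ℓ` divided out.
  have step : ∀ (i : Fin 3) (j : Fin 3), (j : ℕ) = i + 1 → i ≠ 2 →
      contRep 0 τ ((v - v').d i) 0 = 0 →
      D.p * contRep 0 τ ((y - y').d i.succ) 0 + D.q * contRep 0 τ ((y - y').d i.castSucc) 0 = 0 := by
    intro i j hij hi hv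
    obtain ⟨w, w1, w2, w3, -⟩ := (v - v').exists_continuous hτ i j hij
    obtain ⟨a, a1, a2, a3, -⟩ := (y - y').exists_continuous hτ i.succ j.succ (by simp [hij])
    obtain ⟨b, b1, b2, b3, -⟩ := (y - y').exists_continuous hτ i.castSucc i.succ (by simp)
    have e := eqOn_Icc_of_ae hτ (w := fun t => D.obsL (w t))
      (w' := fun t => D.ψ ℓ / ℓ * (D.p * a t + D.q * b t)) (by
        filter_upwards [h.obs_sub hℓ h1 h' i, w2, a2, b2] with t c1 c2 c3 c4
        rw [c2, c3, c4, c1]) (by fun_prop) (by fun_prop) (left_mem_Icc.2 hτ.le)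
    simp only [← w3, ← a3, ← b3, hv, map_zero] at e
    exact (mul_eq_zero.1 e.symm).resolve_left (div_ne_zero h5.1 hℓ.ne')
  have s0 := step 0 1 rfl (by decide) hv0
  have s1 := step 1 2 rfl (by decide) hv1
  change D.p * contRep 0 τ ((y - y').d 1) 0 + D.q * contRep 0 τ ((y - y').d 0) 0 = 0 at s0
  change D.p * contRep 0 τ ((y - y').d 2) 0 + D.q * contRep 0 τ ((y - y').d 1) 0 = 0 at s1
  -- The values descend: `Y''(0) = 0` forces `q Y'(0) = 0`, and this in turn forces `q Y(0) = 0`.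
  have hy1 : contRep 0 τ ((y - y').d 1) 0 = 0 := by
    rw [hy2, mul_zero, zero_add] at s1
    exact (mul_eq_zero.1 s1).resolve_left hq.ne'
  have hy0 : contRep 0 τ ((y - y').d 0) 0 = 0 := by
    rw [hy1, mul_zero, zero_add] at s0
    exact (mul_eq_zero.1 s0).resolve_left hq.ne'
  exact ⟨hv0, hv1, hy0, hy1, hy2⟩

theorem unique (hℓ : 0 < ℓ) (hτ : 0 < τ) (hβ : 0 < D.β) (hq : 0 < D.q) (h1 : D.I1) (h3 : D.I3)
    (h : D.IsSolution v k y) (h' : D.IsSolution v' k' y') (h5 : D.I5 y) (h5' : D.I5 y') :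
    v = v' ∧ k = k' ∧ y = y' := by
  have := completeSpace_H10H2 hℓ
  obtain ⟨i0, i1, j0, j1, j2⟩ := h.init_sub hℓ hτ hq h1 h' h5 h5'
  obtain ⟨w, w1, w2, -, -⟩ := v.exists_continuous hτ 0 1 rfl
  obtain ⟨w', w1', w2', -, -⟩ := v'.exists_continuous hτ 0 1 rfl
  obtain ⟨V, V1, V2, V3, V4⟩ := (v - v').exists_continuous hτ 0 1 rfl
  obtain ⟨V', V1', V2', V3', V4'⟩ := (v - v').exists_continuous hτ 1 2 rfl
  obtain ⟨κ, κ1, κ2, -, -⟩ := k.exists_continuous hτ 0 1 rfl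
  obtain ⟨κ', κ1', κ2', -, -⟩ := k'.exists_continuous hτ 0 1 rfl
  obtain ⟨a, a1, a2, -, -⟩ := y.exists_continuous hτ 0 1 rfl
  obtain ⟨b, b1, b2, -, -⟩ := y.exists_continuous hτ 1 2 rfl
  obtain ⟨a', a1', a2', -, -⟩ := y'.exists_continuous hτ 0 1 rfl
  obtain ⟨b', b1', b2', -, -⟩ := y'.exists_continuous hτ 1 2 rfl
  obtain ⟨Y, Y1, Y2, Y3, Y4⟩ := (y - y').exists_continuous hτ 0 1 rfl
  obtain ⟨Y', Y1', Y2', Y3', Y4'⟩ := (y - y').exists_continuous hτ 1 2 rfl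
  obtain ⟨Y'', Y1'', Y2'', Y3'', Y4''⟩ := (y - y').exists_continuous hτ 2 3 rfl
  rw [← V3, i0] at V4
  rw [← V3', i1] at V4'
  rw [← Y3, j0] at Y4
  rw [← Y3', j1] at Y4'
  rw [← Y3'', j2] at Y4''
  have ew : ∀ t ∈ Icc 0 τ, w t - w' t = V t := eqOn_Icc_of_ae hτ (w := fun t => w t - w' t) (by
    filter_upwards [w2, w2', V2, Lp.coeFn_sub (v.d 0) (v'.d 0)] with t c1 c2 c3 c4
    rw [c1, c2, c3, Sobolev.d_sub, c4, Pi.sub_apply]) (by fun_prop) (by fun_prop)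
  have ea : ∀ t ∈ Icc 0 τ, a t - a' t = Y t := eqOn_Icc_of_ae hτ (w := fun t => a t - a' t) (by
    filter_upwards [a2, a2', Y2, Lp.coeFn_sub (y.d 0) (y'.d 0)] with t c1 c2 c3 c4
    rw [c1, c2, c3, Sobolev.d_sub, c4, Pi.sub_apply]) (by fun_prop) (by fun_prop)
  have eb : ∀ t ∈ Icc 0 τ, b t - b' t = Y' t := eqOn_Icc_of_ae hτ (w := fun t => b t - b' t) (by
    filter_upwards [b2, b2', Y2', Lp.coeFn_sub (y.d 1) (y'.d 1)] with t c1 c2 c3 c4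
    rw [c1, c2, c3, Sobolev.d_sub, c4, Pi.sub_apply]) (by fun_prop) (by fun_prop)
  have ez : D.z y =ᵐ[ivl 0 τ] fun t => D.p * b t + D.q * a t := by
    filter_upwards [a2, b2] with t c1 c2
    rw [c1, c2, z]
  have ez' : D.z y' =ᵐ[ivl 0 τ] fun t => D.p * b' t + D.q * a' t := by
    filter_upwards [a2', b2'] with t c1 c2
    rw [c1, c2, z]
  have cB : ∀ᵐ t ∂(ivl 0 τ), conv (k.d 0) (fun s => H10H2.dxL ℓ 2 (v.d 0 s)) t
      - conv (k'.d 0) (fun s => H10H2.dxL ℓ 2 (v'.d 0 s)) t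
      = conv κ (fun s => H10H2.dxL ℓ 2 (w s)) t - conv κ' (fun s => H10H2.dxL ℓ 2 (w' s)) t := by
    filter_upwards [ae_restrict_mem measurableSet_Ioo] with t ht
    rw [conv_comp_congr _ κ2 w2 (Ioo_subset_Icc_self ht),
      conv_comp_congr _ κ2' w2' (Ioo_subset_Icc_self ht)]
  -- Here `E = H¹₀ ∩ H²` and `H = L²(0, ℓ)`; `P` is the pairing with `φ'`, so that `γ = ∫φ'u₀''` is
  -- nonzero by (i3), and `ξ` is `x/ℓ`.
  have main := eq_zero_of_memory_system hτ (c := min 1 D.β) (p := D.p) (q := D.q)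
    (γ := inner ℝ (D.φ.d 1) (D.u₀.d 2)) (a := contRep 0 ℓ (D.u₀.d 1) ℓ) (r := 1 / ℓ)
    (lt_min one_pos hβ) (by rw [inner_L2, ivl_int hℓ]; exact h3)
    (H10H2.helmholtz ℓ D.β) (H10H2.dxL ℓ 2) (H10H2.dxEndL ℓ) (innerSL ℝ (D.φ.d 1)) (D.u₀.d 2)
    (ramp ℓ) (H10H2.le_norm_helmholtz hℓ hβ) (v₁ := w) (v₂ := w') (V' := V')
    (V'' := (v - v').d 2) (k₁ := κ) (k₂ := κ') (z₁ := fun t => D.p * b t + D.q * a t)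
    (z₂ := fun t => D.p * b' t + D.q * a' t) (Y := Y) (Y' := Y') (Y'' := Y'')
    (Y''' := (y - y').d 3) w1 w1' κ1 κ1' (by fun_prop) (by fun_prop) Y1 Y1' Y1''
    (integrable_Lp _) (integrable_Lp _)
    (fun t ht => by rw [ew t ht, V4 t ht, zero_add, integral_congr_ivl V2' ht])
    (fun t ht => by rw [V4' t ht, zero_add])
    (fun t ht => by rw [Y4 t ht, zero_add, integral_congr_ivl Y2' ht])
    (fun t ht => by rw [Y4' t ht, zero_add, integral_congr_ivl Y2'' ht])
    (fun t ht => by rw [Y4'' t ht, zero_add])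
    (fun t ht => by rw [← ea t ht, ← eb t ht]; ring)
    (by
      filter_upwards [h.wave_L2, h'.wave_L2, cB, w2, w2', κ2, κ2', Y2'',
        Lp.coeFn_sub (v.d 2) (v'.d 2), Lp.coeFn_sub (y.d 2) (y'.d 2),
        Lp.coeFn_sub (y.d 3) (y'.d 3)] with t c1 c2 c3 c4 c5 c6 c7 c8 c9 c10 c11
      rw [← c3, c4, c5, c6, c7, c8, Sobolev.d_sub, Sobolev.d_sub, Sobolev.d_sub, c9, c10, c11]
      simp only [Pi.sub_apply, map_sub]
      have e : (D.p * (y.d 3 t - y'.d 3 t) + D.q * (y.d 2 t - y'.d 2 t))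
          = D.ztt y t - D.ztt y' t := by rw [ztt, ztt]; ring
      rw [e]
      simp only [sub_smul]
      rw [← c1, ← c2]
      module)
    (by
      filter_upwards [h.kernel_sub hℓ h1 h', cB, w2, w2', κ2, κ2'] with t c1 c3 c4 c5 c6 c7
      rw [← c3, c4, c5, c6, c7]
      exact c1)
    (by
      filter_upwards [h.acoustic_L hℓ, h'.acoustic_L hℓ, w2, w2', κ2, κ2', Y2'', ez, ez',
        Lp.coeFn_sub (y.d 2) (y'.d 2), ae_restrict_mem measurableSet_Ioo]
        with t c1 c2 c4 c5 c6 c7 c8 c9 c10 c11 ht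
      have ht' := Ioo_subset_Icc_self ht
      rw [conv_comp_congr _ κ2 w2 ht', conv_comp_congr _ κ2' w2' ht',
        conv_congr κ2 ez.symm ht', conv_congr κ2' ez'.symm ht', ← c9, ← c10, c4, c5, c6,
        c7, c8, Sobolev.d_sub, c11]
      simp only [Pi.sub_apply, map_sub] at c1 c2 ⊢
      linear_combination c1 - c2)
  refine ⟨Sobolev.eq_of_d_zero ?_, Sobolev.eq_of_d_zero ?_, Sobolev.eq_of_d_zero ?_⟩
  · filter_upwards [w2, w2', ae_restrict_mem measurableSet_Ioo] with t c1 c2 ht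
    rw [← c1, ← c2, (main t (Ioo_subset_Icc_self ht)).1]
  · filter_upwards [κ2, κ2', ae_restrict_mem measurableSet_Ioo] with t c1 c2 ht
    rw [← c1, ← c2, (main t (Ioo_subset_Icc_self ht)).2.1]
  · filter_upwards [a2, a2', ae_restrict_mem measurableSet_Ioo] with t c1 c2 ht
    have ht' := Ioo_subset_Icc_self ht
    rw [← c1, ← c2, ← sub_eq_zero, ea t ht', (main t ht').2.2]

end Data.IsSolution

end MemoryKernel

end

open MemoryKernel in
theorem theorem4p2 (ℓ T : ℝ) (hℓ : 0 < ℓ) (hT : 0 < T)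
    (D : Data ℓ T) (hβ : 0 < D.β) (hp : 0 < D.p) (hq : 0 < D.q)
    (h1 : D.I1) (h2 : D.I2) (h3 : D.I3) (h4 : D.I4)
    (τ : ℝ) (hτ : τ ∈ Set.Ioc 0 T)
    (v₁ v₂ : Sobolev 2 0 τ (H10H2 ℓ)) (k₁ k₂ : Sobolev 1 0 τ ℝ) (y₁ y₂ : Sobolev 3 0 τ ℝ)
    (h5₁ : D.I5 y₁) (h5₂ : D.I5 y₂)
    (hs₁ : D.IsSolution v₁ k₁ y₁) (hs₂ : D.IsSolution v₂ k₂ y₂) :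
    v₁ = v₂ ∧ k₁ = k₂ ∧ y₁ = y₂ :=
  hs₁.unique hℓ hτ.1 hβ hq h1 h3 hs₂ h5₁ h5₂
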